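/- Let $G=P2/m$ be the space group with the presentation $$G=\left\langle x,y,z,r,m \;\middle|\; [x,y],\,[x,z],\,[y,z],\,r^2,\,m^2,\,(mr)^2,\; x^m=x,\; y^m=y^{-1},\; z^m=z,\; x^r=x^{-1},\; y^r=y,\; z^r=z^{-1}\right\rangle,$$ where $[a,b]=a^{-1}b^{-1}ab$ and $a^b=b^{-1}ab$. For each integer $n\ge 1$, let $c_n$ be the number of normal subgroups of index $n$ in $G$ (this number is finite). Then, as the real variable $x$ tends to $+\infty$, $$\sum_{n\le x} c_n=\left(\frac{3}{32}+\frac{7\pi^2}{4608}\right)\pi^2x^2+O\left(x\ln^2 x\right),$$ where the sum runs over the integers $1\le n\le x$. -/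

import Mathlib

open Filter Asymptotics

/-- The five generators of the space group `P2/m`: three translations `x, y, z`, the diad rotation
`r` and the reflection `m`. -/
inductive P2mGen : Type
  | x | y | z | r | m

namespace P2m

/-- The generator `x` in the free group. -/
def X : FreeGroup P2mGen := FreeGroup.of P2mGen.x

/-- The generator `y` in the free group. -/
def Y : FreeGroup P2mGen := FreeGroup.of P2mGen.y

/-- The generator `z` in the free group. -/
def Z : FreeGroup P2mGen := FreeGroup.of P2mGen.z

/-- The generator `r` in the free group. -/
def R : FreeGroup P2mGen := FreeGroup.of P2mGen.r

/-- The generator `m` in the free group. -/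
def M : FreeGroup P2mGen := FreeGroup.of P2mGen.m

/-- The defining relators: `[x,y]`, `[x,z]`, `[y,z]`, `r²`, `m²`, `(mr)²`, and the words expressing
`x^m = x`, `y^m = y⁻¹`, `z^m = z`, `x^r = x⁻¹`, `y^r = y`, `z^r = z⁻¹`,
where `[a,b] = a⁻¹ b⁻¹ a b` and `a^b = b⁻¹ a b`; a relation `u = v` is the relator `u v⁻¹`. -/
def relators : Set (FreeGroup P2mGen) :=
  {X⁻¹ * Y⁻¹ * X * Y, X⁻¹ * Z⁻¹ * X * Z, Y⁻¹ * Z⁻¹ * Y * Z,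
    R ^ 2, M ^ 2, (M * R) ^ 2,
    (M⁻¹ * X * M) * X⁻¹, (M⁻¹ * Y * M) * (Y⁻¹)⁻¹, (M⁻¹ * Z * M) * Z⁻¹,
    (R⁻¹ * X * R) * (X⁻¹)⁻¹, (R⁻¹ * Y * R) * Y⁻¹, (R⁻¹ * Z * R) * (Z⁻¹)⁻¹}

end P2m

/-- The space group `P2/m`, given by its standard presentation. -/
abbrev P2mGroup : Type := PresentedGroup P2m.relators

/-- `c_n(G)`: the number of normal subgroups of index `n` in `G` (for `n ≥ 1`, this is finite
whenever `G` is finitely generated, see `finite_normalSubgroups_of_index`). -/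
noncomputable def normalSubgroupCount (G : Type*) [Group G] (n : ℕ) : ℕ :=
  Nat.card {H : Subgroup G // H.Normal ∧ H.index = n}

/-- A group generated by finitely many elements has only finitely many normal subgroups of a given
finite index, so that `normalSubgroupCount` is a genuine count. -/
theorem finite_normalSubgroups_of_index {G : Type*} [Group G] {ι : Type*} [Finite ι] (f : ι → G)
    (hf : Subgroup.closure (Set.range f) = ⊤) (n : ℕ) (hn : n ≠ 0) :
    Finite {H : Subgroup G // H.Normal ∧ H.index = n} := by
  classical
  have key : ∀ H : {H : Subgroup G // H.Normal ∧ H.index = n},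
      ∃ (φ : G →* Equiv.Perm (Fin n)) (i : Fin n), ∀ g, g ∈ H.1 ↔ φ g i = i := by
    rintro ⟨H, _, hH⟩
    have hcard : Nat.card (G ⧸ H) = n := hH
    have : Finite (G ⧸ H) := Nat.finite_of_card_ne_zero (by omega)
    let e : (G ⧸ H) ≃ Fin n := Finite.equivFinOfCardEq hcard
    refine ⟨e.permCongrHom.toMonoidHom.comp (MulAction.toPermHom G (G ⧸ H)),
      e ((1 : G) : G ⧸ H), fun g => ?_⟩
    have h1 : g • ((1 : G) : G ⧸ H) = ((g : G) : G ⧸ H) := by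
      rw [MulAction.Quotient.smul_coe, smul_eq_mul, mul_one]
    simp only [MonoidHom.comp_apply, MulEquiv.coe_toMonoidHom, Equiv.permCongrHom_coe,
      Equiv.permCongr_apply, Equiv.symm_apply_apply, MulAction.toPermHom_apply,
      MulAction.toPerm_apply, EmbeddingLike.apply_eq_iff_eq]
    rw [h1, eq_comm, QuotientGroup.eq, inv_one, one_mul]
  choose φ i h using key
  refine Finite.of_injective
    (fun H => ((fun j => φ H (f j), i H) : (ι → Equiv.Perm (Fin n)) × Fin n)) ?_
  intro H K hHK
  obtain ⟨h1, h2⟩ := Prod.mk.inj hHK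
  have hφ : φ H = φ K := by
    refine MonoidHom.eq_of_eqOn_dense hf ?_
    rintro _ ⟨j, rfl⟩
    exact congrFun h1 j
  apply Subtype.ext
  ext g
  rw [h H g, h K g, hφ, h2]

/-- The counts `c_n` of `P2/m` are counts of finite sets. -/
theorem finite_normalSubgroups_P2m (n : ℕ) (hn : n ≠ 0) :
    Finite {H : Subgroup P2mGroup // H.Normal ∧ H.index = n} := by
  have : Finite P2mGen :=
    Finite.of_surjective (fun k : Fin 5 => match k with
      | 0 => P2mGen.x | 1 => P2mGen.y | 2 => P2mGen.z | 3 => P2mGen.r | 4 => P2mGen.m)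
      (by
        intro g
        cases g
        exacts [⟨0, rfl⟩, ⟨1, rfl⟩, ⟨2, rfl⟩, ⟨3, rfl⟩, ⟨4, rfl⟩])
  exact finite_normalSubgroups_of_index PresentedGroup.of
    (PresentedGroup.closure_range_of P2m.relators) n hn

/-- `g (n / j)` if `j ∣ n`, and `0` otherwise. -/
noncomputable def dilate (j : ℕ) (g : ℕ → ℝ) (n : ℕ) : ℝ := if j ∣ n then g (n / j) else 0

/-- The Dirichlet convolution of `g` with the constant function `1`. -/
noncomputable def divisorSum (g : ℕ → ℝ) (n : ℕ) : ℝ := ∑ p ∈ n.divisorsAntidiagonal, g p.2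

/-- The partial sums of `g` are `a * x ^ 2 + O(x * (1 + log x) ^ p)`. -/
def QuadraticMean (g : ℕ → ℝ) (a : ℝ) (p : ℕ) : Prop :=
  ∃ C, 0 ≤ C ∧ ∀ x : ℝ, 1 ≤ x →
    |∑ k ∈ Finset.Icc 1 ⌊x⌋₊, g k - a * x ^ 2| ≤ C * (x * (1 + Real.log x) ^ p)

theorem sum_dilate {j : ℕ} (hj : 0 < j) (g : ℕ → ℝ) (N : ℕ) :
    ∑ n ∈ Finset.Icc 1 N, dilate j g n = ∑ k ∈ Finset.Icc 1 (N / j), g k := by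
  unfold dilate
  rw [← Finset.sum_filter]
  symm
  refine Finset.sum_nbij' (fun k => j * k) (fun n => n / j) ?_ ?_ ?_ ?_ ?_
  · intro k hk
    simp only [Finset.mem_Icc, Finset.mem_filter] at hk ⊢
    have := (Nat.le_div_iff_mul_le hj).1 hk.2
    exact ⟨⟨Nat.mul_pos hj hk.1, by rwa [mul_comm]⟩, dvd_mul_right _ _⟩
  · intro n hn
    simp only [Finset.mem_Icc, Finset.mem_filter] at hn ⊢
    exact ⟨Nat.div_pos (Nat.le_of_dvd hn.1.1 hn.2) hj, Nat.div_le_div_right hn.1.2⟩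
  · intro k _
    exact Nat.mul_div_cancel_left k hj
  · intro n hn
    exact Nat.mul_div_cancel' (Finset.mem_filter.1 hn).2
  · intro k _
    rw [Nat.mul_div_cancel_left k hj]

theorem sum_divisorSum (g : ℕ → ℝ) (N : ℕ) :
    ∑ n ∈ Finset.Icc 1 N, divisorSum g n
      = ∑ e ∈ Finset.Icc 1 N, ∑ k ∈ Finset.Icc 1 (N / e), g k := by
  unfold divisorSum
  rw [Finset.sum_sigma', Finset.sum_sigma']
  refine Finset.sum_nbij' (fun s => ⟨s.2.1, s.2.2⟩) (fun s => ⟨s.1 * s.2, (s.1, s.2)⟩) ?_ ?_ ?_ ?_ ?_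
  · rintro ⟨n, e, k⟩ h
    simp only [Finset.mem_sigma, Finset.mem_Icc, Nat.mem_divisorsAntidiagonal] at h ⊢
    obtain ⟨⟨h1, h2⟩, rfl, h3⟩ := h
    have he : 0 < e := Nat.pos_of_ne_zero (by rintro rfl; simp at h3)
    have hk : 0 < k := Nat.pos_of_ne_zero (by rintro rfl; simp at h3)
    exact ⟨⟨he, (Nat.le_mul_of_pos_right e hk).trans h2⟩, hk,
      (Nat.le_div_iff_mul_le he).2 (by rwa [mul_comm])⟩
  · rintro ⟨e, k⟩ h
    simp only [Finset.mem_sigma, Finset.mem_Icc, Nat.mem_divisorsAntidiagonal] at h ⊢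
    obtain ⟨⟨h1, h2⟩, h3, h4⟩ := h
    have := (Nat.le_div_iff_mul_le h1).1 h4
    have h5 : 0 < e * k := Nat.mul_pos h1 h3
    exact ⟨⟨h5, by rwa [mul_comm]⟩, by simp, h5.ne'⟩
  · rintro ⟨n, e, k⟩ h
    simp only [Finset.mem_sigma, Finset.mem_Icc, Nat.mem_divisorsAntidiagonal] at h ⊢
    obtain ⟨_, rfl, _⟩ := h
    rfl
  · rintro ⟨e, k⟩ _
    rfl
  · rintro ⟨n, e, k⟩ _
    rfl

theorem one_le_one_add_log_pow {x : ℝ} (hx : 1 ≤ x) (p : ℕ) : 1 ≤ (1 + Real.log x) ^ p :=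
  one_le_pow₀ (by linarith [Real.log_nonneg hx])

namespace QuadraticMean

variable {g h : ℕ → ℝ} {a b : ℝ} {p q : ℕ}

theorem mono (hg : QuadraticMean g a p) (hpq : p ≤ q) : QuadraticMean g a q := by
  obtain ⟨C, hC, H⟩ := hg
  refine ⟨C, hC, fun x hx => (H x hx).trans ?_⟩
  have := Real.log_nonneg hx
  gcongr
  linarith

theorem add (hg : QuadraticMean g a p) (hh : QuadraticMean h b p) :
    QuadraticMean (fun n => g n + h n) (a + b) p := by
  obtain ⟨C, hC, H⟩ := hg
  obtain ⟨D, hD, H'⟩ := hh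
  refine ⟨C + D, by positivity, fun x hx => ?_⟩
  rw [Finset.sum_add_distrib]
  have h1 := H x hx
  have h2 := H' x hx
  rw [add_mul C D]
  refine le_trans (le_of_eq ?_) ((abs_add_le _ _).trans (add_le_add h1 h2))
  congr 1
  ring

theorem const_mul (hg : QuadraticMean g a p) (c : ℝ) :
    QuadraticMean (fun n => c * g n) (c * a) p := by
  obtain ⟨C, hC, H⟩ := hg
  refine ⟨|c| * C, by positivity, fun x hx => ?_⟩
  rw [← Finset.mul_sum, mul_assoc, ← mul_sub, abs_mul, mul_assoc]
  exact mul_le_mul_of_nonneg_left (H x hx) (abs_nonneg c)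

theorem congr (hg : QuadraticMean g a p) (hh : ∀ n, 1 ≤ n → h n = g n) :
    QuadraticMean h a p := by
  obtain ⟨C, hC, H⟩ := hg
  refine ⟨C, hC, fun x hx => ?_⟩
  rw [Finset.sum_congr rfl fun n hn => hh n (Finset.mem_Icc.1 hn).1]
  exact H x hx

theorem of_sum_le {D : ℝ} (hD : 0 ≤ D) (h0 : ∀ n, 0 ≤ g n)
    (hg : ∀ N : ℕ, 1 ≤ N → ∑ k ∈ Finset.Icc 1 N, g k ≤ D * N) : QuadraticMean g 0 p := by
  refine ⟨D, hD, fun x hx => ?_⟩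
  rw [zero_mul, sub_zero, abs_of_nonneg (Finset.sum_nonneg fun n _ => h0 n)]
  refine (hg _ ((Nat.one_le_floor_iff x).2 hx)).trans (mul_le_mul_of_nonneg_left ?_ hD)
  refine (Nat.floor_le (by linarith)).trans ?_
  exact le_mul_of_one_le_right (by linarith) (one_le_one_add_log_pow hx p)

theorem cast_id : QuadraticMean (fun n => (n : ℝ)) (1 / 2) 0 := by
  refine ⟨1, zero_le_one, fun x hx => ?_⟩
  have hs : ∀ N : ℕ, ∑ k ∈ Finset.Icc 1 N, (k : ℝ) = N * (N + 1) / 2 := by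
    intro N
    induction N with
    | zero => simp
    | succ N ih =>
      rw [Finset.sum_Icc_succ_top (by omega), ih]
      push_cast
      ring
  rw [hs]
  have h1 := Nat.floor_le (show (0 : ℝ) ≤ x by linarith)
  have h2 := Nat.lt_floor_add_one x
  have h0 : (0 : ℝ) ≤ ⌊x⌋₊ := Nat.cast_nonneg _
  rw [abs_le]
  constructor <;> nlinarith

theorem dilate (hg : QuadraticMean g a p) {j : ℕ} (hj : 0 < j) :
    QuadraticMean (dilate j g) (a / j ^ 2) p := by
  obtain ⟨C, hC, H⟩ := hg
  have hj' : (1 : ℝ) ≤ j := by exact_mod_cast hj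
  refine ⟨C + |a|, by positivity, fun x hx => ?_⟩
  have hlx := Real.log_nonneg hx
  rw [sum_dilate hj, ← Nat.floor_div_natCast]
  have hdiv : a / (j : ℝ) ^ 2 * x ^ 2 = a * (x / j) ^ 2 := by
    rw [div_pow]; ring
  rw [hdiv]
  have hle : x / j ≤ x := div_le_self (by linarith) hj'
  have hpos : 0 < x / j := by positivity
  have hone := one_le_one_add_log_pow hx p
  rcases le_or_gt 1 (x / j) with h1 | h1
  · refine (H _ h1).trans ?_
    have hl := Real.log_le_log hpos hle
    have hl0 := Real.log_nonneg h1
    have : x / j * (1 + Real.log (x / j)) ^ p ≤ x * (1 + Real.log x) ^ p := by gcongr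
    have hX : 0 ≤ x * (1 + Real.log x) ^ p := by positivity
    rw [add_mul]
    nlinarith [abs_nonneg a, mul_nonneg (abs_nonneg a) hX, mul_le_mul_of_nonneg_left this hC]
  · rw [Nat.floor_eq_zero.2 h1]
    simp only [Finset.Icc_eq_empty_of_lt zero_lt_one, Finset.sum_empty, zero_sub, abs_neg, abs_mul]
    have h2 : |(x / j) ^ 2| ≤ x * (1 + Real.log x) ^ p := by
      rw [abs_of_nonneg (by positivity)]
      nlinarith
    have hX : 0 ≤ x * (1 + Real.log x) ^ p := by positivity
    rw [add_mul]
    nlinarith [mul_le_mul_of_nonneg_left h2 (abs_nonneg a), mul_nonneg hC hX]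

end QuadraticMean

theorem sum_inv_le_one_add_log (x : ℝ) (hx : 1 ≤ x) :
    ∑ e ∈ Finset.Icc 1 ⌊x⌋₊, (1 / (e : ℝ)) ≤ 1 + Real.log x := by
  have := harmonic_floor_le_one_add_log x hx
  rw [harmonic_eq_sum_Icc] at this
  push_cast at this
  simpa [one_div] using this

theorem sum_inv_sq_sub_zeta_two (x : ℝ) (hx : 1 ≤ x) :
    |∑ e ∈ Finset.Icc 1 ⌊x⌋₊, (1 / (e : ℝ) ^ 2) - Real.pi ^ 2 / 6| ≤ 2 / x := by
  have hN := (Nat.one_le_floor_iff x).2 hx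
  set N := ⌊x⌋₊ with hNdef
  have hsum := hasSum_zeta_two
  have hIcc : ∀ M : ℕ, ∑ e ∈ Finset.Icc 1 M, (1 / (e : ℝ) ^ 2)
      = ∑ e ∈ Finset.range (M + 1), (1 / (e : ℝ) ^ 2) := by
    intro M
    rw [Finset.range_eq_Ico, Finset.sum_eq_sum_Ico_succ_bot (by omega)]
    simp
    rfl
  have hle : ∑ e ∈ Finset.Icc 1 N, (1 / (e : ℝ) ^ 2) ≤ Real.pi ^ 2 / 6 := by
    rw [hIcc]
    exact sum_le_hasSum _ (fun i _ => by positivity) hsum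
  have hge : Real.pi ^ 2 / 6 ≤ ∑ e ∈ Finset.Icc 1 N, (1 / (e : ℝ) ^ 2) + 1 / N := by
    refine le_of_tendsto hsum.tendsto_sum_nat ?_
    filter_upwards [eventually_ge_atTop (N + 1)] with M hM
    rw [hIcc]
    have key : ∀ t : ℕ, ∑ e ∈ Finset.range (N + 1 + t), (1 / (e : ℝ) ^ 2)
        ≤ ∑ e ∈ Finset.range (N + 1), (1 / (e : ℝ) ^ 2) + (1 / N - 1 / ((N : ℝ) + t)) := by
      intro t
      induction t with
      | zero => simp
      | succ t ih =>
        rw [← add_assoc, Finset.sum_range_succ]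
        have hN' : (1 : ℝ) ≤ N := by exact_mod_cast hN
        have : 1 / (((N + 1 + t : ℕ) : ℝ)) ^ 2 ≤ 1 / ((N : ℝ) + t) - 1 / ((N : ℝ) + (t + 1 : ℕ)) := by
          push_cast
          have h1 : (0 : ℝ) < N + t := by positivity
          have h2 : (0 : ℝ) < N + (t + 1) := by positivity
          rw [div_sub_div _ _ h1.ne' h2.ne', div_le_div_iff₀ (by positivity) (by positivity)]
          nlinarith
        linarith
    obtain ⟨t, rfl⟩ := Nat.exists_eq_add_of_le hM
    refine (key t).trans ?_
    have : (0 : ℝ) ≤ 1 / ((N : ℝ) + t) := by positivity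
    linarith
  have hNx : 1 / (N : ℝ) ≤ 2 / x := by
    have h2 := Nat.lt_floor_add_one x
    rw [← hNdef] at h2
    have hN' : (1 : ℝ) ≤ N := by exact_mod_cast hN
    rw [div_le_div_iff₀ (by linarith) (by linarith)]
    linarith
  rw [abs_le]
  constructor
  · linarith
  · have : 0 ≤ 2 / x := by positivity
    linarith

theorem QuadraticMean.divisorSum {g : ℕ → ℝ} {a : ℝ} {p : ℕ} (hg : QuadraticMean g a p) :
    QuadraticMean (divisorSum g) (a * (Real.pi ^ 2 / 6)) (p + 1) := by
  obtain ⟨C, hC, H⟩ := hg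
  refine ⟨C + 2 * |a|, by positivity, fun x hx => ?_⟩
  have hx0 : 0 < x := by linarith
  have hlx := Real.log_nonneg hx
  rw [sum_divisorSum]
  have hterm : ∀ e ∈ Finset.Icc 1 ⌊x⌋₊,
      |∑ k ∈ Finset.Icc 1 (⌊x⌋₊ / e), g k - a * (x / e) ^ 2|
        ≤ C * (x * (1 + Real.log x) ^ p) * (1 / (e : ℝ)) := by
    intro e he
    rw [Finset.mem_Icc] at he
    have he0 : (1 : ℝ) ≤ e := by exact_mod_cast he.1
    have hex : (e : ℝ) ≤ x := (Nat.le_floor_iff hx0.le).1 he.2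
    have h1 : 1 ≤ x / e := (one_le_div (by linarith)).2 hex
    have hle : x / e ≤ x := div_le_self hx0.le he0
    rw [← Nat.floor_div_natCast]
    refine (H _ h1).trans ?_
    have hl := Real.log_le_log (by linarith) hle
    have hl0 := Real.log_nonneg h1
    calc C * (x / e * (1 + Real.log (x / e)) ^ p)
        ≤ C * (x / e * (1 + Real.log x) ^ p) := by gcongr
      _ = _ := by ring
  have hsplit : ∑ e ∈ Finset.Icc 1 ⌊x⌋₊, ∑ k ∈ Finset.Icc 1 (⌊x⌋₊ / e), g k
        - a * (Real.pi ^ 2 / 6) * x ^ 2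
      = ∑ e ∈ Finset.Icc 1 ⌊x⌋₊, (∑ k ∈ Finset.Icc 1 (⌊x⌋₊ / e), g k - a * (x / e) ^ 2)
        + a * x ^ 2 * (∑ e ∈ Finset.Icc 1 ⌊x⌋₊, (1 / (e : ℝ) ^ 2) - Real.pi ^ 2 / 6) := by
    rw [Finset.sum_sub_distrib, mul_sub, Finset.mul_sum]
    have : ∑ e ∈ Finset.Icc 1 ⌊x⌋₊, a * (x / e) ^ 2
        = ∑ e ∈ Finset.Icc 1 ⌊x⌋₊, a * x ^ 2 * (1 / (e : ℝ) ^ 2) :=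
      Finset.sum_congr rfl fun e _ => by rw [div_pow]; ring
    rw [this]
    ring
  rw [hsplit, add_mul]
  refine (abs_add_le _ _).trans (add_le_add ?_ ?_)
  · refine (Finset.abs_sum_le_sum_abs _ _).trans ((Finset.sum_le_sum hterm).trans ?_)
    rw [← Finset.mul_sum, pow_succ]
    calc C * (x * (1 + Real.log x) ^ p) * ∑ e ∈ Finset.Icc 1 ⌊x⌋₊, (1 / (e : ℝ))
        ≤ C * (x * (1 + Real.log x) ^ p) * (1 + Real.log x) := by
          gcongr
          exact sum_inv_le_one_add_log x hx
      _ = _ := by ring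
  · rw [abs_mul, abs_mul, abs_of_nonneg (sq_nonneg x)]
    calc |a| * x ^ 2 * |∑ e ∈ Finset.Icc 1 ⌊x⌋₊, (1 / (e : ℝ) ^ 2) - Real.pi ^ 2 / 6|
        ≤ |a| * x ^ 2 * (2 / x) := by
          gcongr
          exact sum_inv_sq_sub_zeta_two x hx
      _ = 2 * |a| * (x * 1) := by field_simp
      _ ≤ _ := by
          gcongr
          exact one_le_one_add_log_pow hx _

theorem QuadraticMean.isBigO {g : ℕ → ℝ} {a : ℝ} (hg : QuadraticMean g a 2) :
    (fun x : ℝ => ∑ n ∈ Finset.Icc 1 ⌊x⌋₊, g n - a * x ^ 2)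
      =O[atTop] (fun x : ℝ => x * Real.log x ^ 2) := by
  obtain ⟨C, hC, H⟩ := hg
  refine IsBigO.of_bound (C * 4) ?_
  filter_upwards [eventually_ge_atTop 1,
    Real.tendsto_log_atTop.eventually_ge_atTop 1] with x hx hl
  have h0 : 0 ≤ x * Real.log x ^ 2 := by positivity
  rw [Real.norm_eq_abs, Real.norm_of_nonneg h0, mul_assoc]
  refine (H x hx).trans (mul_le_mul_of_nonneg_left ?_ hC)
  have : (1 + Real.log x) ^ 2 ≤ 4 * Real.log x ^ 2 := by nlinarith
  calc x * (1 + Real.log x) ^ 2 ≤ x * (4 * Real.log x ^ 2) := by gcongr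
    _ = _ := by ring

@[to_additive]
theorem Subgroup.index_eq_card_of_surjective {G α : Type*} [Group G] {N : Subgroup G} (F : G → α)
    (hF : Function.Surjective F) (h : ∀ x y, x⁻¹ * y ∈ N ↔ F x = F y) :
    N.index = Nat.card α := by
  refine Nat.card_congr (Equiv.ofBijective
    (Quotient.lift F fun x y hxy => (h x y).1 (QuotientGroup.leftRel_apply.1 hxy)) ⟨?_, ?_⟩)
  · intro p q
    induction p using QuotientGroup.induction_on with | _ x => ?_
    induction q using QuotientGroup.induction_on with | _ y => ?_
    intro hxy
    exact QuotientGroup.eq.2 ((h x y).2 hxy)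
  · intro z
    obtain ⟨x, rfl⟩ := hF z
    exact ⟨QuotientGroup.mk x, rfl⟩

/-- The elements of order dividing two of the quotient by `B`. -/
abbrev TwoTorsion {A : Type*} [AddCommGroup A] (B : AddSubgroup A) : Type _ :=
  {t : A ⧸ B // 2 • t = 0}

section Slope

variable {A : Type*} [AddCommGroup A]

/-- The subgroup of `ℤ × A` of all `(e * j, v)` such that `v` represents `j • t`. -/
def slopeSubgroup (e : ℕ) (B : AddSubgroup A) (t : A ⧸ B) : AddSubgroup (ℤ × A) where
  carrier := {w | ∃ j : ℤ, w.1 = e * j ∧ (w.2 : A ⧸ B) = j • t}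
  zero_mem' := ⟨0, by simp, by simp⟩
  add_mem' := by
    rintro w w' ⟨j, h1, h2⟩ ⟨k, h3, h4⟩
    refine ⟨j + k, ?_, ?_⟩
    · rw [Prod.fst_add, h1, h3, mul_add]
    · rw [Prod.snd_add, QuotientAddGroup.mk_add, h2, h4, add_zsmul]
  neg_mem' := by
    rintro w ⟨j, h1, h2⟩
    refine ⟨-j, ?_, ?_⟩
    · rw [Prod.fst_neg, h1, mul_neg]
    · rw [Prod.snd_neg, QuotientAddGroup.mk_neg, h2, neg_zsmul]

variable {e : ℕ} {B : AddSubgroup A} {t : A ⧸ B}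

theorem mem_slopeSubgroup {w : ℤ × A} :
    w ∈ slopeSubgroup e B t ↔ ∃ j : ℤ, w.1 = e * j ∧ (w.2 : A ⧸ B) = j • t := Iff.rfl

theorem mem_slopeSubgroup_zero (he : 0 < e) {v : A} :
    ((0, v) : ℤ × A) ∈ slopeSubgroup e B t ↔ v ∈ B := by
  rw [mem_slopeSubgroup, ← QuotientAddGroup.eq_zero_iff]
  constructor
  · rintro ⟨j, h1, h2⟩
    have hj : j = 0 := by
      rcases mul_eq_zero.1 h1.symm with h | h
      · omega
      · exact h
    simpa [hj] using h2
  · intro h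
    exact ⟨0, by simp, by simpa using h⟩

theorem mem_slopeSubgroup_self (he : 0 < e) {v : A} :
    ((e, v) : ℤ × A) ∈ slopeSubgroup e B t ↔ (v : A ⧸ B) = t := by
  rw [mem_slopeSubgroup]
  constructor
  · rintro ⟨j, h1, h2⟩
    have hj : j = 1 := by
      have : (e : ℤ) * 1 = e * j := by simpa using h1
      exact (mul_left_cancel₀ (by omega) this).symm
    simpa [hj] using h2
  · intro h
    exact ⟨1, by simp, by simpa using h⟩

theorem index_slopeSubgroup (he : 0 < e) : (slopeSubgroup e B t).index = e * B.index := by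
  have : NeZero e := ⟨he.ne'⟩
  have hZ : (e : ℤ) ≠ 0 := by omega
  rw [AddSubgroup.index_eq_card_of_surjective
    (fun w : ℤ × A => (((w.1 : ZMod e), (w.2 : A ⧸ B) - (w.1 / e) • t) : ZMod e × (A ⧸ B)))]
  · rw [Nat.card_prod, Nat.card_zmod]
    rfl
  · rintro ⟨z, q⟩
    obtain ⟨v, rfl⟩ := QuotientAddGroup.mk_surjective q
    refine ⟨(z.val, v), ?_⟩
    have : (z.val : ℤ) / e = 0 := Int.ediv_eq_zero_of_lt (by omega) (by exact_mod_cast z.val_lt)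
    rw [Prod.mk.injEq]
    exact ⟨by simp, by simp only [this, zero_zsmul, sub_zero]⟩
  · rintro ⟨x, v⟩ ⟨y, w⟩
    rw [mem_slopeSubgroup, Prod.mk.injEq, ZMod.intCast_eq_intCast_iff_dvd_sub]
    simp only [Prod.neg_mk, Prod.mk_add_mk, QuotientAddGroup.mk_add, QuotientAddGroup.mk_neg]
    have key : ∀ j : ℤ, -x + y = e * j → y / e = x / e + j := by
      intro j hj
      rw [show y = x + e * j by linarith, Int.add_mul_ediv_left _ _ hZ]
    constructor
    · rintro ⟨j, h1, h2⟩
      refine ⟨⟨j, by linarith⟩, ?_⟩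
      rw [key j h1, add_zsmul, ← h2]
      abel
    · rintro ⟨⟨j, h1⟩, h2⟩
      have h3 : -x + y = e * j := by linarith
      refine ⟨j, h3, ?_⟩
      rw [key j h3, add_zsmul] at h2
      rw [← sub_eq_zero] at h2 ⊢
      rw [← neg_eq_zero, ← h2]
      abel

theorem exists_eq_slopeSubgroup (L : AddSubgroup (ℤ × A)) (hL : L.index ≠ 0) :
    ∃ (e : ℕ) (B : AddSubgroup A) (t : A ⧸ B), 0 < e ∧ L = slopeSubgroup e B t := by
  obtain ⟨n, hn⟩ := Int.subgroup_cyclic (L.map (AddMonoidHom.fst ℤ A))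
  have hmem : ∀ y : ℤ, (∃ v, (y, v) ∈ L) ↔ ∃ j : ℤ, y = n.natAbs * j := by
    intro y
    have h1 : (∃ v, (y, v) ∈ L) ↔ y ∈ L.map (AddMonoidHom.fst ℤ A) := by
      simp [AddSubgroup.mem_map]
    rw [h1, hn, ← AddSubgroup.zmultiples_eq_closure, Int.mem_zmultiples_iff, ← Int.natAbs_dvd]
    rfl
  have hpos : 0 < n.natAbs := by
    rw [Nat.pos_iff_ne_zero]
    intro h0
    have h1 : ((L.index : ℤ), (0 : A)) ∈ L := by
      have := L.nsmul_index_mem (1, 0)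
      simpa using this
    obtain ⟨j, hj⟩ := (hmem _).1 ⟨0, h1⟩
    rw [h0] at hj
    simp at hj
    exact hL hj
  obtain ⟨t, ht⟩ := (hmem n.natAbs).2 ⟨1, by simp⟩
  refine ⟨n.natAbs, L.comap (AddMonoidHom.inr ℤ A), (t : A ⧸ _), hpos, ?_⟩
  have hkey : ∀ (j : ℤ) (v : A), (n.natAbs * j, v) ∈ L ↔
      (v : A ⧸ L.comap (AddMonoidHom.inr ℤ A)) = j • (t : A ⧸ L.comap (AddMonoidHom.inr ℤ A)) := by
    intro j v
    rw [← QuotientAddGroup.mk_zsmul, eq_comm, QuotientAddGroup.eq, AddSubgroup.mem_comap]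
    have : AddMonoidHom.inr ℤ A (-(j • t) + v)
        = -(j • ((n.natAbs : ℤ), t)) + ((n.natAbs : ℤ) * j, v) := by
      ext
      · simp; ring
      · simp
    rw [this, AddSubgroup.add_mem_cancel_left _ (neg_mem (zsmul_mem ht j))]
  ext ⟨y, v⟩
  rw [mem_slopeSubgroup]
  constructor
  · intro h
    obtain ⟨j, rfl⟩ := (hmem y).1 ⟨v, h⟩
    exact ⟨j, rfl, (hkey j v).1 h⟩
  · rintro ⟨j, h1, h2⟩
    simp only at h1 h2
    subst h1
    exact (hkey j v).2 h2

theorem slopeSubgroup_injective {e' : ℕ} {B' : AddSubgroup A} {t' : A ⧸ B'} (he : 0 < e)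
    (he' : 0 < e') (h : slopeSubgroup e B t = slopeSubgroup e' B' t') :
    e = e' ∧ B = B' ∧ t ≍ t' := by
  have hdvd : ∀ {e e' : ℕ} {B B' : AddSubgroup A} {t : A ⧸ B} {t' : A ⧸ B'},
      slopeSubgroup e B t = slopeSubgroup e' B' t' → e' ∣ e := by
    intro e e' B B' t t' h
    obtain ⟨v, hv⟩ := QuotientAddGroup.mk_surjective t
    have h1 : ((e, v) : ℤ × A) ∈ slopeSubgroup e B t := ⟨1, by simp, by simpa using hv⟩
    rw [h] at h1
    obtain ⟨j, hj, _⟩ := h1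
    exact Int.natCast_dvd_natCast.1 ⟨j, hj⟩
  obtain rfl : e = e' := Nat.dvd_antisymm (hdvd h.symm) (hdvd h)
  obtain rfl : B = B' := by
    ext v
    rw [← mem_slopeSubgroup_zero (t := t) he, h, mem_slopeSubgroup_zero he]
  refine ⟨rfl, rfl, heq_of_eq ?_⟩
  obtain ⟨v, rfl⟩ := QuotientAddGroup.mk_surjective t
  exact (mem_slopeSubgroup_self he).1 (h ▸ (mem_slopeSubgroup_self he).2 rfl)

/-- The subgroups of index `k` of `ℤ × A`. -/
noncomputable def slopeEquiv (A : Type*) [AddCommGroup A] {k : ℕ} (hk : k ≠ 0) :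
    (Σ p : k.divisorsAntidiagonal, Σ B : {B : AddSubgroup A // B.index = p.1.2}, A ⧸ B.1) ≃
      {L : AddSubgroup (ℤ × A) // L.index = k} :=
  Equiv.ofBijective
    (fun d => ⟨slopeSubgroup d.1.1.1 d.2.1.1 d.2.2, by
      obtain ⟨⟨⟨e, c⟩, hp⟩, ⟨B, hB⟩, t⟩ := d
      obtain ⟨h1, h2⟩ := Nat.mem_divisorsAntidiagonal.1 hp
      simp only at h1 hB ⊢
      rw [index_slopeSubgroup (Nat.pos_of_ne_zero (by rintro rfl; simp at h1; omega)), hB, h1]⟩) <| by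
    constructor
    · rintro ⟨⟨⟨e, c⟩, hp⟩, ⟨B, hB⟩, t⟩ ⟨⟨⟨e', c'⟩, hp'⟩, ⟨B', hB'⟩, t'⟩ h
      have h1 := (Nat.mem_divisorsAntidiagonal.1 hp).1
      have h1' := (Nat.mem_divisorsAntidiagonal.1 hp').1
      simp only at h1 h1' hB hB'
      obtain ⟨rfl, rfl, h4⟩ := slopeSubgroup_injective
        (Nat.pos_of_ne_zero (by rintro rfl; simp at h1; omega))
        (Nat.pos_of_ne_zero (by rintro rfl; simp at h1'; omega)) (Subtype.ext_iff.1 h)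
      obtain rfl := eq_of_heq h4
      subst hB
      subst hB'
      rfl
    · rintro ⟨L, hL⟩
      obtain ⟨e, B, t, he, rfl⟩ := exists_eq_slopeSubgroup L (by omega)
      rw [index_slopeSubgroup he] at hL
      exact ⟨⟨⟨(e, B.index), Nat.mem_divisorsAntidiagonal.2 ⟨hL, hk⟩⟩, ⟨B, rfl⟩, t⟩, rfl⟩

theorem mk_slopeSubgroup_eq {i i' : ℤ} {v v' : A} :
    (((i, v) : ℤ × A) : (ℤ × A) ⧸ slopeSubgroup e B t) = ((i', v') : ℤ × A) ↔
      ∃ j : ℤ, i' - i = e * j ∧ (v' : A ⧸ B) - v = j • t := by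
  rw [QuotientAddGroup.eq, mem_slopeSubgroup]
  simp [neg_add_eq_sub]

theorem two_nsmul_mk_slopeSubgroup_eq_zero {i : ℤ} {v : A} :
    2 • (((i, v) : ℤ × A) : (ℤ × A) ⧸ slopeSubgroup e B t) = 0 ↔
      ∃ j : ℤ, 2 * i = e * j ∧ 2 • (v : A ⧸ B) = j • t := by
  rw [← QuotientAddGroup.mk_nsmul, QuotientAddGroup.eq_zero_iff, mem_slopeSubgroup]
  simp

/-- The two-torsion of the quotient by `slopeSubgroup e B t`. -/
noncomputable def twoTorsionSlopeEquiv (he : 0 < e) (B : AddSubgroup A) (t : A ⧸ B) :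
    TwoTorsion B ⊕ {s : A ⧸ B // Even e ∧ 2 • s = t} ≃ TwoTorsion (slopeSubgroup e B t) :=
  Equiv.ofBijective
    (Sum.elim
      (fun s => ⟨((0, s.1.out) : ℤ × A), two_nsmul_mk_slopeSubgroup_eq_zero.2
        ⟨0, by simp, by simpa using s.2⟩⟩)
      (fun s => ⟨(((e / 2 : ℕ), s.1.out) : ℤ × A), two_nsmul_mk_slopeSubgroup_eq_zero.2
        ⟨1, by have := Nat.two_mul_div_two_of_even s.2.1; push_cast; omega, by simpa using s.2.2⟩⟩)) <| by
    constructor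
    · have hsame : ∀ (i : ℤ) (s s' : A ⧸ B),
          (((i, s.out) : ℤ × A) : (ℤ × A) ⧸ slopeSubgroup e B t) = ((i, s'.out) : ℤ × A) →
            s = s' := by
        intro i s s' h
        obtain ⟨j, h1, h2⟩ := mk_slopeSubgroup_eq.1 h
        have hj : j = 0 := by
          rcases mul_eq_zero.1 (h1.symm.trans (sub_self i)) with h | h
          · omega
          · exact h
        rw [hj, zero_zsmul, QuotientAddGroup.out_eq', QuotientAddGroup.out_eq', sub_eq_zero] at h2
        exact h2.symm
      have hdiff : ∀ s s' : A ⧸ B, Even e →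
          (((0, s.out) : ℤ × A) : (ℤ × A) ⧸ slopeSubgroup e B t) ≠ (((e / 2 : ℕ), s'.out) : ℤ × A) := by
        intro s s' hev h
        obtain ⟨j, h1, _⟩ := mk_slopeSubgroup_eq.1 h
        obtain ⟨f, rfl⟩ := hev
        have hf : ((f + f) / 2 : ℕ) = f := by omega
        rw [hf] at h1
        have h2 : (f : ℤ) * (2 * j - 1) = 0 := by push_cast at h1; linarith
        rcases mul_eq_zero.1 h2 with h | h <;> omega
      rintro (s | s) (s' | s') h
      · exact congrArg Sum.inl (Subtype.ext (hsame _ _ _ (Subtype.ext_iff.1 h)))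
      · exact absurd (Subtype.ext_iff.1 h) (hdiff _ _ s'.2.1)
      · exact absurd (Subtype.ext_iff.1 h).symm (hdiff _ _ s.2.1)
      · exact congrArg Sum.inr (Subtype.ext (hsame _ _ _ (Subtype.ext_iff.1 h)))
    · rintro ⟨q, hq⟩
      obtain ⟨⟨i, v⟩, rfl⟩ := QuotientAddGroup.mk_surjective q
      obtain ⟨j, h1, h2⟩ := two_nsmul_mk_slopeSubgroup_eq_zero.1 hq
      rcases Int.even_or_odd' j with ⟨h, rfl | rfl⟩
      · refine ⟨Sum.inl ⟨(v : A ⧸ B) - h • t, ?_⟩, Subtype.ext ?_⟩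
        · rw [smul_sub, h2, mul_comm, mul_zsmul]
          simp [two_nsmul, two_zsmul]
        · refine mk_slopeSubgroup_eq.2 ⟨h, by linarith, ?_⟩
          rw [QuotientAddGroup.out_eq', sub_sub_cancel]
      · have hev : Even e := by
          have : Even ((e : ℤ) * (2 * h + 1)) := ⟨i, by linarith⟩
          rcases Int.even_mul.1 this with h' | h'
          · exact_mod_cast h'
          · exact absurd h' (Int.not_even_iff_odd.2 ⟨h, rfl⟩)
        refine ⟨Sum.inr ⟨(v : A ⧸ B) - h • t, hev, ?_⟩, Subtype.ext ?_⟩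
        · rw [smul_sub, h2, add_zsmul, mul_comm, mul_zsmul]
          simp [two_nsmul, two_zsmul]
        · have hf := Nat.two_mul_div_two_of_even hev
          refine mk_slopeSubgroup_eq.2 ⟨h, ?_, ?_⟩
          · have hf' : 2 * ((e / 2 : ℕ) : ℤ) = e := by exact_mod_cast hf
            rw [mul_add, ← hf'] at h1
            rw [← hf']
            linarith
          · rw [QuotientAddGroup.out_eq', sub_sub_cancel]

end Slope

section Count

variable {Q : Type*} [AddCommGroup Q]

theorem card_sigma_halves [Finite Q] :
    Nat.card (Σ t : Q, {s : Q // 2 • s = t}) = Nat.card Q :=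
  Nat.card_congr (Equiv.sigmaFiberEquiv fun s : Q => 2 • s)

theorem card_sigma_halves_sq :
    Nat.card (Σ t : Q, {s : Q // 2 • s = t} × {s : Q // 2 • s = t})
      = Nat.card Q * Nat.card {s : Q // 2 • s = 0} := by
  rw [← Nat.card_prod]
  refine Nat.card_congr
    { toFun := fun d => (d.2.1.1, ⟨d.2.2.1 - d.2.1.1, ?_⟩)
      invFun := fun d => ⟨2 • d.1, ⟨d.1, rfl⟩, ⟨d.1 + d.2.1, ?_⟩⟩
      left_inv := ?_
      right_inv := ?_ }
  · rw [smul_sub, d.2.2.2, d.2.1.2, sub_self]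
  · rw [smul_add, d.2.2, add_zero]
  · rintro ⟨_, ⟨s, rfl⟩, ⟨s', h⟩⟩
    simp
  · rintro ⟨s, d⟩
    simp

end Count

/-- The indicator of evenness. -/
def evenInd (n : ℕ) : ℕ := if Even n then 1 else 0

theorem evenInd_sq (n : ℕ) : evenInd n * evenInd n = evenInd n := by
  unfold evenInd; split_ifs <;> rfl

section Sums

variable {A : Type*} [AddCommGroup A] {e : ℕ} {B : AddSubgroup A}

theorem card_twoTorsion_slopeSubgroup [Finite (A ⧸ B)] (he : 0 < e) (t : A ⧸ B) :
    Nat.card (TwoTorsion (slopeSubgroup e B t))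
      = Nat.card (TwoTorsion B) + evenInd e * Nat.card {s : A ⧸ B // 2 • s = t} := by
  rw [← Nat.card_congr (twoTorsionSlopeEquiv he B t), Nat.card_sum]
  congr 1
  unfold evenInd
  split_ifs with h <;> simp [h]

theorem card_sigma_twoTorsion_slopeSubgroup [Finite (A ⧸ B)] (he : 0 < e) :
    Nat.card (Σ t : A ⧸ B, TwoTorsion (slopeSubgroup e B t))
      = B.index * (Nat.card (TwoTorsion B) + evenInd e) := by
  have := Fintype.ofFinite (A ⧸ B)
  have hfin : ∀ t, Finite (TwoTorsion (slopeSubgroup e B t)) := fun t =>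
    Finite.of_equiv _ (twoTorsionSlopeEquiv he B t)
  have h1 := card_sigma_halves (Q := A ⧸ B)
  rw [Nat.card_sigma] at h1
  rw [Nat.card_sigma]
  simp only [card_twoTorsion_slopeSubgroup he]
  rw [Finset.sum_add_distrib, ← Finset.mul_sum, h1, Finset.sum_const, Finset.card_univ,
    ← Nat.card_eq_fintype_card, AddSubgroup.index]
  simp only [smul_eq_mul]
  ring

theorem card_sigma_twoTorsion_slopeSubgroup_sq [Finite (A ⧸ B)] (he : 0 < e) :
    Nat.card (Σ t : A ⧸ B, TwoTorsion (slopeSubgroup e B t) × TwoTorsion (slopeSubgroup e B t))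
      = B.index * (Nat.card (TwoTorsion B) ^ 2 + 3 * evenInd e * Nat.card (TwoTorsion B)) := by
  have := Fintype.ofFinite (A ⧸ B)
  have hfin : ∀ t, Finite (TwoTorsion (slopeSubgroup e B t)) := fun t =>
    Finite.of_equiv _ (twoTorsionSlopeEquiv he B t)
  have h1 := card_sigma_halves (Q := A ⧸ B)
  have h2 := card_sigma_halves_sq (Q := A ⧸ B)
  rw [Nat.card_sigma] at h1 h2
  simp only [Nat.card_prod] at h2
  rw [Nat.card_sigma]
  simp only [Nat.card_prod, card_twoTorsion_slopeSubgroup he]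
  have hterm : ∀ x n : ℕ, (x + evenInd e * n) * (x + evenInd e * n)
      = x * x + (2 * x * evenInd e) * n + evenInd e * (n * n) := by
    intro x n
    have := evenInd_sq e
    calc _ = x * x + (2 * x * evenInd e) * n + (evenInd e * evenInd e) * (n * n) := by ring
      _ = _ := by rw [this]
  simp only [hterm]
  rw [Finset.sum_add_distrib, Finset.sum_add_distrib, ← Finset.mul_sum, ← Finset.mul_sum,
    ← Finset.mul_sum, h1, h2, Finset.sum_const, Finset.card_univ, ← Nat.card_eq_fintype_card, AddSubgroup.index]
  simp only [smul_eq_mul]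
  ring

end Sums

theorem card_twoTorsion_int (B : AddSubgroup ℤ) (hB : B.index ≠ 0) :
    Nat.card (TwoTorsion B) = 1 + evenInd B.index := by
  have : Finite (ℤ ⧸ B) := Nat.finite_of_card_ne_zero hB
  have : IsAddCyclic (ℤ ⧸ B) :=
    isAddCyclic_of_surjective (QuotientAddGroup.mk' B) (QuotientAddGroup.mk'_surjective B)
  have h := IsAddCyclic.card_nsmulAddMonoidHom_ker (G := ℤ ⧸ B) 2
  have h2 : Nat.card (TwoTorsion B) = Nat.card (nsmulAddMonoidHom 2 : (ℤ ⧸ B) →+ ℤ ⧸ B).ker := rfl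
  rw [h2, h]
  change Nat.gcd B.index 2 = _
  unfold evenInd
  split_ifs with h
  · simp [Nat.gcd_eq_right h.two_dvd]
  · exact Nat.coprime_two_right.2 (Nat.not_even_iff_odd.1 h)

theorem Int.eq_zmultiples_of_index {B : AddSubgroup ℤ} {c : ℕ} (h : B.index = c) :
    B = AddSubgroup.zmultiples (c : ℤ) := by
  obtain ⟨a, ha⟩ := Int.subgroup_cyclic B
  rw [← AddSubgroup.zmultiples_eq_closure] at ha
  rw [ha, Int.index_zmultiples] at h
  rw [ha, ← h, Int.zmultiples_natAbs]

instance Int.uniqueSubgroupOfIndex (c : ℕ) : Unique {B : AddSubgroup ℤ // B.index = c} where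
  default := ⟨AddSubgroup.zmultiples (c : ℤ), by simp [Int.index_zmultiples]⟩
  uniq B := Subtype.ext (Int.eq_zmultiples_of_index B.2)

/-- The subgroups of index `k` of `ℤ × ℤ`. -/
abbrev PlaneLattice (k : ℕ) : Type := {L : AddSubgroup (ℤ × ℤ) // L.index = k}

theorem card_sigma_planeLattice {k : ℕ} (hk : k ≠ 0) (X : AddSubgroup (ℤ × ℤ) → Type)
    (w : ℕ × ℕ → ℕ)
    (hX : ∀ p ∈ k.divisorsAntidiagonal, ∀ B : AddSubgroup ℤ, B.index = p.2 →
      Finite (Σ t : ℤ ⧸ B, X (slopeSubgroup p.1 B t)) ∧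
      Nat.card (Σ t : ℤ ⧸ B, X (slopeSubgroup p.1 B t)) = w p) :
    Finite (Σ L : PlaneLattice k, X L.1) ∧
      Nat.card (Σ L : PlaneLattice k, X L.1) = ∑ p ∈ k.divisorsAntidiagonal, w p := by
  let E : (Σ p : k.divisorsAntidiagonal, Σ B : {B : AddSubgroup ℤ // B.index = p.1.2},
      Σ t : ℤ ⧸ B.1, X (slopeSubgroup p.1.1 B.1 t)) ≃ Σ L : PlaneLattice k, X L.1 :=
    ((Equiv.sigmaCongrRight fun _ => (Equiv.sigmaAssoc _).symm).trans
      (Equiv.sigmaAssoc _).symm).trans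
      (Equiv.sigmaCongrLeft (β := fun L : PlaneLattice k => X L.1) (slopeEquiv ℤ hk))
  have hfin : ∀ p : k.divisorsAntidiagonal, ∀ B : {B : AddSubgroup ℤ // B.index = p.1.2},
      Finite (Σ t : ℤ ⧸ B.1, X (slopeSubgroup p.1.1 B.1 t)) := fun p B => (hX p.1 p.2 B.1 B.2).1
  refine ⟨Finite.of_equiv _ E, ?_⟩
  rw [← Nat.card_congr E, Nat.card_sigma, ← Finset.sum_coe_sort _ w]
  refine Finset.sum_congr rfl fun p _ => ?_
  rw [Nat.card_congr (Equiv.uniqueSigma _)]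
  exact (hX p.1 p.2 _ (default : {B : AddSubgroup ℤ // B.index = p.1.2}).2).2

/-- The number of pairs of a sublattice of index `k` and a two-torsion class modulo it. -/
noncomputable def torsionMarkedCount (k : ℕ) : ℕ :=
  Nat.card (Σ L : PlaneLattice k, TwoTorsion L.1)

/-- The number of triples of a sublattice of index `k` and two two-torsion classes modulo it. -/
noncomputable def torsionBimarkedCount (k : ℕ) : ℕ :=
  Nat.card (Σ L : PlaneLattice k, TwoTorsion L.1 × TwoTorsion L.1)

theorem finite_and_torsionMarkedCount_eq {k : ℕ} (hk : k ≠ 0) :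
    Finite (Σ L : PlaneLattice k, TwoTorsion L.1) ∧ torsionMarkedCount k =
      ∑ p ∈ k.divisorsAntidiagonal, p.2 * (1 + evenInd p.2 + evenInd p.1) := by
  refine card_sigma_planeLattice hk TwoTorsion _ fun p hp B hB => ?_
  obtain ⟨h1, -⟩ := Nat.mem_divisorsAntidiagonal.1 hp
  have h0 : p.1 ≠ 0 ∧ p.2 ≠ 0 := by rw [← mul_ne_zero_iff, h1]; exact hk
  have hB0 : B.index ≠ 0 := by rw [hB]; exact h0.2
  have : Finite (ℤ ⧸ B) := Nat.finite_of_card_ne_zero hB0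
  have hpos := Nat.pos_of_ne_zero h0.1
  have hfin : ∀ t, Finite (TwoTorsion (slopeSubgroup p.1 B t)) := fun t =>
    Finite.of_equiv _ (twoTorsionSlopeEquiv hpos B t)
  refine ⟨inferInstance, ?_⟩
  rw [card_sigma_twoTorsion_slopeSubgroup hpos, card_twoTorsion_int B hB0, hB]

theorem finite_and_torsionBimarkedCount_eq {k : ℕ} (hk : k ≠ 0) :
    Finite (Σ L : PlaneLattice k, TwoTorsion L.1 × TwoTorsion L.1) ∧ torsionBimarkedCount k =
      ∑ p ∈ k.divisorsAntidiagonal,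
        p.2 * (1 + 3 * evenInd p.2 + 3 * evenInd p.1 + 3 * (evenInd p.1 * evenInd p.2)) := by
  refine card_sigma_planeLattice hk (fun L => TwoTorsion L × TwoTorsion L) _ fun p hp B hB => ?_
  obtain ⟨h1, -⟩ := Nat.mem_divisorsAntidiagonal.1 hp
  have h0 : p.1 ≠ 0 ∧ p.2 ≠ 0 := by rw [← mul_ne_zero_iff, h1]; exact hk
  have hB0 : B.index ≠ 0 := by rw [hB]; exact h0.2
  have : Finite (ℤ ⧸ B) := Nat.finite_of_card_ne_zero hB0
  have hpos := Nat.pos_of_ne_zero h0.1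
  have hfin : ∀ t, Finite (TwoTorsion (slopeSubgroup p.1 B t)) := fun t =>
    Finite.of_equiv _ (twoTorsionSlopeEquiv hpos B t)
  refine ⟨inferInstance, ?_⟩
  rw [card_sigma_twoTorsion_slopeSubgroup_sq hpos, card_twoTorsion_int B hB0, hB]
  have := evenInd_sq p.2
  linear_combination (p.2 : ℕ) * this

/-- The isometries `(a, b) ↦ (s * a + y, u • b + v)` of `ℤ × ℤ²` with signs `s` and `u`. -/
@[ext] structure P2mModel where
  /-- The translation part in the first factor. -/
  y : ℤ
  /-- The translation part in the second factor. -/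
  v : ℤ × ℤ
  /-- The linear part in the first factor. -/
  s : ℤˣ
  /-- The linear part in the second factor. -/
  u : ℤˣ

namespace P2mModel

instance : Mul P2mModel :=
  ⟨fun g h => ⟨g.y + g.s * h.y, g.v + (g.u : ℤ) • h.v, g.s * h.s, g.u * h.u⟩⟩

instance : One P2mModel := ⟨⟨0, 0, 1, 1⟩⟩

instance : Inv P2mModel := ⟨fun g => ⟨-(g.s * g.y), -((g.u : ℤ) • g.v), g.s, g.u⟩⟩

@[simp] theorem mul_y (g h : P2mModel) : (g * h).y = g.y + g.s * h.y := rfl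
@[simp] theorem mul_v (g h : P2mModel) : (g * h).v = g.v + (g.u : ℤ) • h.v := rfl
@[simp] theorem mul_s (g h : P2mModel) : (g * h).s = g.s * h.s := rfl
@[simp] theorem mul_u (g h : P2mModel) : (g * h).u = g.u * h.u := rfl
@[simp] theorem one_y : (1 : P2mModel).y = 0 := rfl
@[simp] theorem one_v : (1 : P2mModel).v = 0 := rfl
@[simp] theorem one_s : (1 : P2mModel).s = 1 := rfl
@[simp] theorem one_u : (1 : P2mModel).u = 1 := rfl
@[simp] theorem inv_y (g : P2mModel) : (g⁻¹).y = -(g.s * g.y) := rfl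
@[simp] theorem inv_v (g : P2mModel) : (g⁻¹).v = -((g.u : ℤ) • g.v) := rfl
@[simp] theorem inv_s (g : P2mModel) : (g⁻¹).s = g.s := rfl
@[simp] theorem inv_u (g : P2mModel) : (g⁻¹).u = g.u := rfl

theorem units_coe_mul_self (s : ℤˣ) : (s : ℤ) * s = 1 := Int.units_coe_mul_self s

instance : Group P2mModel :=
  Group.ofLeftAxioms
    (fun g h k => by
      ext1
      · simp only [mul_y, mul_s, Units.val_mul]; ring
      · simp only [mul_v, mul_u, Units.val_mul, smul_add, mul_smul]; abel
      · simp only [mul_s, mul_assoc]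
      · simp only [mul_u, mul_assoc])
    (fun g => by ext1 <;> simp)
    (fun g => by ext1 <;> simp)

/-- The translations. -/
def trans (w : ℤ × (ℤ × ℤ)) : P2mModel := ⟨w.1, w.2, 1, 1⟩

theorem trans_add (w w' : ℤ × (ℤ × ℤ)) : trans (w + w') = trans w * trans w' := by
  ext1 <;> simp [trans]

theorem trans_zero : trans 0 = 1 := rfl

theorem trans_neg (w : ℤ × (ℤ × ℤ)) : trans (-w) = (trans w)⁻¹ := by
  ext1 <;> simp [trans]

theorem mul_inv_eq_trans {g h : P2mModel} (hs : g.s = h.s) (hu : g.u = h.u) :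
    g * h⁻¹ = trans (g.y - h.y, g.v - h.v) := by
  ext1
  · simp only [mul_y, inv_y, trans, hs, mul_neg, ← mul_assoc, units_coe_mul_self]; ring
  · simp only [mul_v, inv_v, trans, hu, smul_neg, ← mul_smul, units_coe_mul_self, one_smul]; abel
  · simp [trans, hs]
  · simp [trans, hu]

theorem conj_y (h g : P2mModel) : (h * g * h⁻¹).y = h.s * g.y + (h.y - g.s * h.y) := by
  simp only [mul_y, mul_s, inv_y, Units.val_mul]
  linear_combination (-(g.s : ℤ) * h.y) * units_coe_mul_self h.s

theorem conj_v (h g : P2mModel) :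
    (h * g * h⁻¹).v = (h.u : ℤ) • g.v + (h.v - (g.u : ℤ) • h.v) := by
  simp only [mul_v, mul_u, inv_v, Units.val_mul, smul_neg, ← mul_smul]
  rw [show (h.u : ℤ) * g.u * h.u = g.u by linear_combination (g.u : ℤ) * units_coe_mul_self h.u]
  abel

theorem conj_s (h g : P2mModel) : (h * g * h⁻¹).s = g.s := by
  simp [mul_comm h.s, mul_assoc]

theorem conj_u (h g : P2mModel) : (h * g * h⁻¹).u = g.u := by
  simp [mul_comm h.u, mul_assoc]

theorem conj_eq (h g : P2mModel) : h * g * h⁻¹ =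
    ⟨h.s * g.y + (h.y - g.s * h.y), (h.u : ℤ) • g.v + (h.v - (g.u : ℤ) • h.v), g.s, g.u⟩ :=
  P2mModel.ext (conj_y h g) (conj_v h g) (conj_s h g) (conj_u h g)

section Subgroups

variable {N : Subgroup P2mModel}

theorem mem_iff_trans_mem {g h : P2mModel} (hh : h ∈ N) (hs : g.s = h.s) (hu : g.u = h.u) :
    g ∈ N ↔ trans (g.y - h.y, g.v - h.v) ∈ N := by
  rw [← mul_inv_eq_trans hs hu, Subgroup.mul_mem_cancel_right N (inv_mem hh)]

theorem trans_sub_mem {g h : P2mModel} (hg : g ∈ N) (hh : h ∈ N) (hs : g.s = h.s)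
    (hu : g.u = h.u) : trans (g.y - h.y, g.v - h.v) ∈ N :=
  (mem_iff_trans_mem hh hs hu).1 hg

/-- The lattice of translations in a subgroup. -/
def translationLattice (N : Subgroup P2mModel) : AddSubgroup (ℤ × (ℤ × ℤ)) where
  carrier := {w | trans w ∈ N}
  zero_mem' := N.one_mem
  add_mem' := by
    intro w w' hw hw'
    simp only [Set.mem_ofPred_eq, trans_add] at *
    exact mul_mem hw hw'
  neg_mem' := by
    intro w hw
    simp only [Set.mem_ofPred_eq, trans_neg] at *
    exact inv_mem hw

theorem mem_translationLattice {w : ℤ × (ℤ × ℤ)} : w ∈ translationLattice N ↔ trans w ∈ N := Iff.rfl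

theorem conj_mem_of_normal (hN : N.Normal) {g : P2mModel} (hg : g ∈ N) (y : ℤ) (v : ℤ × ℤ)
    (s u : ℤˣ) :
    (⟨s * g.y + (y - g.s * y), (u : ℤ) • g.v + (v - (g.u : ℤ) • v), g.s, g.u⟩ : P2mModel) ∈ N := by
  have := hN.conj_mem g hg ⟨y, v, s, u⟩
  rwa [conj_eq] at this

theorem two_mul_y_mem (hN : N.Normal) {g : P2mModel} (hg : g ∈ N) :
    (2 * g.y, 0) ∈ translationLattice N := by
  have h := trans_sub_mem hg (conj_mem_of_normal hN hg 0 0 (-1) 1) rfl rfl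
  rw [mem_translationLattice]
  convert h using 2
  simp
  ring

theorem two_mul_v_mem (hN : N.Normal) {g : P2mModel} (hg : g ∈ N) :
    (0, 2 • g.v) ∈ translationLattice N := by
  have h := trans_sub_mem hg (conj_mem_of_normal hN hg 0 0 1 (-1)) rfl rfl
  rw [mem_translationLattice]
  convert h using 2
  simp [two_mul]

theorem two_mem_of_s_eq (hN : N.Normal) {g : P2mModel} (hg : g ∈ N) (hs : g.s = -1) :
    (2, 0) ∈ translationLattice N := by
  have h := trans_sub_mem (conj_mem_of_normal hN hg 1 0 1 1) hg rfl rfl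
  rw [mem_translationLattice]
  convert h using 2
  simp [hs]

theorem two_nsmul_mem_of_u_eq (hN : N.Normal) {g : P2mModel} (hg : g ∈ N) (hu : g.u = -1)
    (w : ℤ × ℤ) : (0, 2 • w) ∈ translationLattice N := by
  have h := trans_sub_mem (conj_mem_of_normal hN hg 0 w 1 1) hg rfl rfl
  rw [mem_translationLattice]
  convert h using 2
  simp [hu, two_mul]

/-- Invariance of a lattice under the reflection in the first coordinate. -/
def IsMirrorInvariant (Λ : AddSubgroup (ℤ × (ℤ × ℤ))) : Prop := ∀ w ∈ Λ, (-w.1, w.2) ∈ Λ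

theorem isMirrorInvariant_slopeSubgroup_iff {e : ℕ} (he : 0 < e) {L : AddSubgroup (ℤ × ℤ)}
    {t : (ℤ × ℤ) ⧸ L} : IsMirrorInvariant (slopeSubgroup e L t) ↔ 2 • t = 0 := by
  constructor
  · intro h
    obtain ⟨v, rfl⟩ := QuotientAddGroup.mk_surjective t
    have h1 := (mem_slopeSubgroup_self (B := L) he).2 (rfl : (v : (ℤ × ℤ) ⧸ L) = v)
    have h2 := add_mem h1 (h _ h1)
    rw [Prod.mk_add_mk, add_neg_cancel, mem_slopeSubgroup_zero he, ← QuotientAddGroup.eq_zero_iff] at h2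
    rw [two_nsmul]
    exact h2
  · rintro ht w ⟨j, h1, h2⟩
    refine ⟨-j, by rw [h1, mul_neg], ?_⟩
    simp only
    rw [h2, neg_zsmul, eq_neg_iff_add_eq_zero, ← two_nsmul, smul_comm, ht, smul_zero]

theorem IsMirrorInvariant.sign_mem {Λ : AddSubgroup (ℤ × (ℤ × ℤ))} (h : IsMirrorInvariant Λ)
    {w : ℤ × (ℤ × ℤ)} (hw : w ∈ Λ) (s u : ℤˣ) : ((s : ℤ) * w.1, (u : ℤ) • w.2) ∈ Λ := by
  rcases Int.units_eq_one_or s with rfl | rfl <;> rcases Int.units_eq_one_or u with rfl | rfl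
  · simpa using hw
  · simpa using neg_mem (h w hw)
  · simpa using h w hw
  · simpa only [Units.val_neg, Units.val_one, neg_mul, one_mul, neg_smul, one_smul]
      using (show (-w.1, -w.2) ∈ Λ from neg_mem hw)

theorem IsMirrorInvariant.sign_mem_iff {Λ : AddSubgroup (ℤ × (ℤ × ℤ))} (h : IsMirrorInvariant Λ)
    {w : ℤ × (ℤ × ℤ)} (s u : ℤˣ) : ((s : ℤ) * w.1, (u : ℤ) • w.2) ∈ Λ ↔ w ∈ Λ := by
  refine ⟨fun hw => ?_, fun hw => h.sign_mem hw s u⟩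
  have := h.sign_mem hw s u
  simpa only [← mul_assoc, ← mul_smul, units_coe_mul_self, one_mul, one_smul] using this

/-- The subgroup of translations by a mirror-invariant lattice. -/
def translationSubgroup (Λ : AddSubgroup (ℤ × (ℤ × ℤ))) : Subgroup P2mModel where
  carrier := {g | g.s = 1 ∧ g.u = 1 ∧ (g.y, g.v) ∈ Λ}
  one_mem' := ⟨rfl, rfl, Λ.zero_mem⟩
  mul_mem' := by
    rintro g h ⟨h1, h2, h3⟩ ⟨h4, h5, h6⟩
    refine ⟨by simp [h1, h4], by simp [h2, h5], ?_⟩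
    have := add_mem h3 h6
    simpa [h1, h2] using this
  inv_mem' := by
    rintro g ⟨h1, h2, h3⟩
    refine ⟨h1, h2, ?_⟩
    have := neg_mem h3
    simpa [h1, h2] using this

theorem mem_translationSubgroup {Λ : AddSubgroup (ℤ × (ℤ × ℤ))} {g : P2mModel} :
    g ∈ translationSubgroup Λ ↔ g.s = 1 ∧ g.u = 1 ∧ (g.y, g.v) ∈ Λ := Iff.rfl

theorem translationLattice_translationSubgroup (Λ : AddSubgroup (ℤ × (ℤ × ℤ))) :
    translationLattice (translationSubgroup Λ) = Λ := by
  ext w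
  rw [mem_translationLattice, mem_translationSubgroup]
  simp [trans]

theorem normal_translationSubgroup {Λ : AddSubgroup (ℤ × (ℤ × ℤ))} (h : IsMirrorInvariant Λ) :
    (translationSubgroup Λ).Normal := by
  refine ⟨?_⟩
  rintro g ⟨h1, h2, h3⟩ k
  rw [conj_eq]
  refine ⟨h1, h2, ?_⟩
  simpa [h1, h2] using h.sign_mem h3 k.s k.u

theorem index_translationSubgroup {Λ : AddSubgroup (ℤ × (ℤ × ℤ))} (h : IsMirrorInvariant Λ) :
    (translationSubgroup Λ).index = 4 * Λ.index := by
  rw [Subgroup.index_eq_card_of_surjective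
    (fun g : P2mModel => ((g.s, g.u, ((g.y, g.v) : ℤ × (ℤ × ℤ))) : ℤˣ × ℤˣ × (_ ⧸ Λ)))]
  · rw [Nat.card_prod, Nat.card_prod, ← mul_assoc]
    have : Nat.card ℤˣ = 2 := by rw [Nat.card_eq_fintype_card]; rfl
    rw [this]
    rfl
  · rintro ⟨s, u, q⟩
    obtain ⟨⟨y, v⟩, rfl⟩ := QuotientAddGroup.mk_surjective q
    exact ⟨⟨y, v, s, u⟩, rfl⟩
  · intro g k
    rw [mem_translationSubgroup, Prod.mk.injEq, Prod.mk.injEq, QuotientAddGroup.eq]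
    simp only [mul_s, inv_s, mul_u, inv_u, mul_y, inv_y, mul_v, inv_v]
    rw [mul_eq_one_iff_eq_inv, mul_eq_one_iff_eq_inv, Int.units_inv_eq_self, Int.units_inv_eq_self,
      ← h.sign_mem_iff (w := -(g.y, g.v) + (k.y, k.v)) g.s g.u]
    simp [mul_add, smul_add]

theorem eq_translationSubgroup (hs : ∀ g ∈ N, g.s = 1) (hu : ∀ g ∈ N, g.u = 1) :
    N = translationSubgroup (translationLattice N) := by
  ext g
  rw [mem_translationSubgroup, mem_translationLattice]
  constructor
  · intro hg
    have h1 := hs g hg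
    have h2 := hu g hg
    refine ⟨h1, h2, ?_⟩
    convert hg using 1
    ext1 <;> simp [trans, h1, h2]
  · rintro ⟨h1, h2, h3⟩
    convert h3 using 1
    ext1 <;> simp [trans, h1, h2]

theorem isMirrorInvariant_translationLattice (hN : N.Normal) :
    IsMirrorInvariant (translationLattice N) := by
  intro w hw
  have := conj_mem_of_normal hN hw 0 0 (-1) 1
  simpa [trans, mem_translationLattice] using this

/-- The normal subgroups of translations. -/
def translationSubgroupEquiv (n : ℕ) :
    {Λ : AddSubgroup (ℤ × (ℤ × ℤ)) // IsMirrorInvariant Λ ∧ 4 * Λ.index = n} ≃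
    {N : Subgroup P2mModel // (N.Normal ∧ N.index = n) ∧ (∀ g ∈ N, g.u = 1) ∧ ∀ g ∈ N, g.s = 1} where
  toFun Λ := ⟨translationSubgroup Λ.1,
    ⟨normal_translationSubgroup Λ.2.1, by rw [index_translationSubgroup Λ.2.1, Λ.2.2]⟩,
    fun _ hg => hg.2.1, fun _ hg => hg.1⟩
  invFun N := ⟨translationLattice N.1, isMirrorInvariant_translationLattice N.2.1.1, by
    rw [← index_translationSubgroup (isMirrorInvariant_translationLattice N.2.1.1),
      ← eq_translationSubgroup N.2.2.2 N.2.2.1, N.2.1.2]⟩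
  left_inv Λ := Subtype.ext (translationLattice_translationSubgroup Λ.1)
  right_inv N := Subtype.ext (eq_translationSubgroup N.2.2.2 N.2.2.1).symm

/-- `t` for the sign `-1` and `0` for the sign `1`. -/
def signPart {Q : Type*} [AddCommGroup Q] (s : ℤˣ) (t : Q) : Q := if s = 1 then 0 else t

@[simp] theorem signPart_one {Q : Type*} [AddCommGroup Q] (t : Q) : signPart 1 t = 0 := rfl

@[simp] theorem signPart_neg_one {Q : Type*} [AddCommGroup Q] (t : Q) : signPart (-1) t = t := rfl

theorem signPart_mul {Q : Type*} [AddCommGroup Q] {t : Q} (ht : 2 • t = 0) (s s' : ℤˣ) :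
    signPart (s * s') t = signPart s t + signPart s' t := by
  rw [two_nsmul] at ht
  rcases Int.units_eq_one_or s with rfl | rfl <;> rcases Int.units_eq_one_or s' with rfl | rfl <;>
    simp [ht]

theorem neg_signPart {Q : Type*} [AddCommGroup Q] {t : Q} (ht : 2 • t = 0) (s : ℤˣ) :
    -signPart s t = signPart s t := by
  rw [two_nsmul] at ht
  rcases Int.units_eq_one_or s with rfl | rfl
  · simp
  · simp [neg_eq_of_add_eq_zero_left ht]

section Reflection

variable {Λ : AddSubgroup (ℤ × (ℤ × ℤ))}

theorem mk_sign_left (hΛ : (2, 0) ∈ Λ) (s : ℤˣ) (y : ℤ) (v : ℤ × ℤ) :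
    (((s : ℤ) * y, v) : (ℤ × (ℤ × ℤ)) ⧸ Λ) = ((y, v) : ℤ × (ℤ × ℤ)) := by
  rcases Int.units_eq_one_or s with rfl | rfl
  · simp
  · rw [QuotientAddGroup.eq]
    convert zsmul_mem hΛ y using 1
    ext <;> simp
    ring

theorem mk_sign (hΛ : (2, 0) ∈ Λ) (s u : ℤˣ) (y : ℤ) (v : ℤ × ℤ) :
    (((s : ℤ) * y, (u : ℤ) • v) : (ℤ × (ℤ × ℤ)) ⧸ Λ)
      = (u : ℤ) • (((y, v) : ℤ × (ℤ × ℤ)) : (ℤ × (ℤ × ℤ)) ⧸ Λ) := by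
  rw [mk_sign_left hΛ, ← mk_sign_left hΛ u, ← QuotientAddGroup.mk_zsmul]
  rfl

theorem sign_zsmul_eq_iff {Q : Type*} [AddCommGroup Q] {a b : Q} (hb : -b = b) (u : ℤˣ) :
    (u : ℤ) • a = b ↔ a = b := by
  rcases Int.units_eq_one_or u with rfl | rfl
  · simp
  · rw [Units.val_neg, Units.val_one, neg_smul, one_smul, neg_eq_iff_eq_neg, hb]

theorem sub_eq_add_iff_of_neg_eq {Q : Type*} [AddCommGroup Q] {x y a b : Q} (ha : -a = a) :
    y - x = a + b ↔ x - a = y - b := by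
  rw [sub_eq_add_neg x a, ha, sub_eq_iff_eq_add, eq_sub_iff_add_eq, eq_comm]
  exact Eq.congr (by abel) rfl

/-- The subgroup with translation lattice `Λ` whose reflections have translation part in the
class `t`. -/
def reflectionSubgroup (Λ : AddSubgroup (ℤ × (ℤ × ℤ))) (hΛ : (2, 0) ∈ Λ) (t : TwoTorsion Λ) :
    Subgroup P2mModel where
  carrier := {g | g.u = 1 ∧ (((g.y, g.v) : ℤ × (ℤ × ℤ)) : (ℤ × (ℤ × ℤ)) ⧸ Λ) = signPart g.s t.1}
  one_mem' := ⟨rfl, QuotientAddGroup.mk_zero Λ⟩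
  mul_mem' := by
    rintro g h ⟨h1, h2⟩ ⟨h3, h4⟩
    refine ⟨by simp [h1, h3], ?_⟩
    simp only [mul_y, mul_v, mul_s]
    rw [← Prod.mk_add_mk, QuotientAddGroup.mk_add, mk_sign hΛ, h2, h4, h1, signPart_mul t.2]
    simp
  inv_mem' := by
    rintro g ⟨h1, h2⟩
    refine ⟨h1, ?_⟩
    simp only [inv_y, inv_v, inv_s]
    rw [← Prod.neg_mk, QuotientAddGroup.mk_neg, mk_sign hΛ, h2, h1]
    simp [neg_signPart t.2]

variable {hΛ : (2, 0) ∈ Λ} {t : TwoTorsion Λ}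

theorem mem_reflectionSubgroup {g : P2mModel} : g ∈ reflectionSubgroup Λ hΛ t ↔
    g.u = 1 ∧ (((g.y, g.v) : ℤ × (ℤ × ℤ)) : (ℤ × (ℤ × ℤ)) ⧸ Λ) = signPart g.s t.1 := Iff.rfl

theorem normal_reflectionSubgroup : (reflectionSubgroup Λ hΛ t).Normal := by
  refine ⟨?_⟩
  rintro g ⟨h1, h2⟩ k
  rw [conj_eq]
  refine ⟨h1, ?_⟩
  simp only [h1, Units.val_one, one_smul, sub_self]
  have h3 : (((k.y - g.s * k.y, 0) : ℤ × (ℤ × ℤ)) : (ℤ × (ℤ × ℤ)) ⧸ Λ) = 0 := by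
    rw [show ((k.y - g.s * k.y, 0) : ℤ × (ℤ × ℤ)) = (k.y, 0) - (g.s * k.y, 0) by simp,
      QuotientAddGroup.mk_sub, mk_sign_left hΛ, sub_self]
  rw [← Prod.mk_add_mk, QuotientAddGroup.mk_add, h3, add_zero, mk_sign hΛ,
    sign_zsmul_eq_iff (neg_signPart t.2 _), h2]

theorem index_reflectionSubgroup : (reflectionSubgroup Λ hΛ t).index = 2 * Λ.index := by
  rw [Subgroup.index_eq_card_of_surjective (fun g : P2mModel =>
    ((g.u, (((g.y, g.v) : ℤ × (ℤ × ℤ)) : (ℤ × (ℤ × ℤ)) ⧸ Λ) - signPart g.s t.1) : ℤˣ × (_ ⧸ Λ)))]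
  · rw [Nat.card_prod]
    have : Nat.card ℤˣ = 2 := by rw [Nat.card_eq_fintype_card]; rfl
    rw [this]
    rfl
  · rintro ⟨u, q⟩
    obtain ⟨⟨y, v⟩, rfl⟩ := QuotientAddGroup.mk_surjective q
    exact ⟨⟨y, v, 1, u⟩, by simp⟩
  · intro g k
    rw [mem_reflectionSubgroup, Prod.mk.injEq]
    simp only [mul_s, inv_s, mul_u, inv_u, mul_y, inv_y, mul_v, inv_v]
    rw [mul_eq_one_iff_eq_inv, Int.units_inv_eq_self, signPart_mul t.2]
    refine and_congr Iff.rfl ?_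
    rw [show ((-(g.s * g.y) + g.s * k.y, -((g.u : ℤ) • g.v) + (g.u : ℤ) • k.v) : ℤ × (ℤ × ℤ))
      = ((g.s : ℤ) * (k.y - g.y), (g.u : ℤ) • (k.v - g.v)) by
        ext <;> simp <;> ring, mk_sign hΛ, sign_zsmul_eq_iff
        (by rw [neg_add, neg_signPart t.2, neg_signPart t.2]), ← Prod.mk_sub_mk,
      QuotientAddGroup.mk_sub]
    exact sub_eq_add_iff_of_neg_eq (neg_signPart t.2 g.s)

theorem translationLattice_reflectionSubgroup :
    translationLattice (reflectionSubgroup Λ hΛ t) = Λ := by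
  ext w
  rw [mem_translationLattice, mem_reflectionSubgroup]
  simp [trans, QuotientAddGroup.eq_zero_iff]

end Reflection

theorem exists_eq_reflectionSubgroup (hN : N.Normal) (hu : ∀ g ∈ N, g.u = 1) {g : P2mModel}
    (hg : g ∈ N) (hs : g.s = -1) :
    ∃ t, N = reflectionSubgroup (translationLattice N) (two_mem_of_s_eq hN hg hs) t := by
  refine ⟨⟨((g.y, g.v) : ℤ × (ℤ × ℤ)), ?_⟩, ?_⟩
  · rw [← QuotientAddGroup.mk_nsmul, QuotientAddGroup.eq_zero_iff]
    convert add_mem (two_mul_y_mem hN hg) (two_mul_v_mem hN hg) using 1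
    simp
  · ext k
    rw [mem_reflectionSubgroup]
    have key : k.u = 1 → (k ∈ N ↔
        (((k.y, k.v) : ℤ × (ℤ × ℤ)) : (ℤ × (ℤ × ℤ)) ⧸ translationLattice N)
          = signPart k.s (((g.y, g.v) : ℤ × (ℤ × ℤ)) : (ℤ × (ℤ × ℤ)) ⧸ translationLattice N)) := by
      intro h
      rcases Int.units_eq_one_or k.s with h' | h'
      · rw [h', signPart_one, QuotientAddGroup.eq_zero_iff, mem_translationLattice]
        have : k = trans (k.y, k.v) := by ext1 <;> simp [trans, h, h']
        rw [← this]
      · rw [mem_iff_trans_mem hg (h'.trans hs.symm) (h.trans (hu g hg).symm), h', signPart_neg_one,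
          eq_comm, QuotientAddGroup.eq, mem_translationLattice]
        simp [neg_add_eq_sub]
    constructor
    · intro hk
      exact ⟨hu k hk, (key (hu k hk)).1 hk⟩
    · rintro ⟨h1, h2⟩
      exact (key h1).2 h2

/-- The normal subgroups containing reflections, but no isometry with `u = -1`. -/
noncomputable def reflectionSubgroupEquiv (n : ℕ) :
    (Σ Λ : {Λ : AddSubgroup (ℤ × (ℤ × ℤ)) // (2, 0) ∈ Λ ∧ 2 * Λ.index = n}, TwoTorsion Λ.1) ≃
    {N : Subgroup P2mModel // (N.Normal ∧ N.index = n) ∧ (∀ g ∈ N, g.u = 1) ∧ ¬ ∀ g ∈ N, g.s = 1} :=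
  Equiv.ofBijective
    (fun d => ⟨reflectionSubgroup d.1.1 d.1.2.1 d.2,
      ⟨normal_reflectionSubgroup, by rw [index_reflectionSubgroup, d.1.2.2]⟩, fun _ hg => hg.1, by
        obtain ⟨⟨y, v⟩, hw⟩ := QuotientAddGroup.mk_surjective d.2.1
        intro h
        have := h ⟨y, v, -1, 1⟩ ⟨rfl, by simpa using hw⟩
        exact absurd this (show (-1 : ℤˣ) ≠ 1 by decide)⟩) <| by
    constructor
    · rintro ⟨⟨Λ, hΛ⟩, t⟩ ⟨⟨Λ', hΛ'⟩, t'⟩ h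
      have h1 := Subtype.ext_iff.1 h
      simp only at h1
      obtain rfl : Λ = Λ' := by
        rw [← translationLattice_reflectionSubgroup (hΛ := hΛ.1) (t := t), h1,
          translationLattice_reflectionSubgroup]
      obtain ⟨⟨y, v⟩, hw⟩ := QuotientAddGroup.mk_surjective t.1
      have hmem : (⟨y, v, -1, 1⟩ : P2mModel) ∈ reflectionSubgroup Λ hΛ.1 t :=
        ⟨rfl, by simpa using hw⟩
      rw [h1] at hmem
      have h2 : t.1 = t'.1 := hw.symm.trans (by simpa using hmem.2)
      rw [Subtype.ext h2]
    · rintro ⟨N, ⟨hN, hn⟩, hu, hs⟩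
      push Not at hs
      obtain ⟨g, hg, hgs⟩ := hs
      have hgs' : g.s = -1 := (Int.units_eq_one_or g.s).resolve_left hgs
      obtain ⟨t, ht⟩ := exists_eq_reflectionSubgroup hN hu hg hgs'
      refine ⟨⟨⟨translationLattice N, two_mem_of_s_eq hN hg hgs', ?_⟩, t⟩, Subtype.ext ht.symm⟩
      rw [← index_reflectionSubgroup (hΛ := two_mem_of_s_eq hN hg hgs') (t := t), ← ht, hn]

end Subgroups

end P2mModel

namespace P2mModel

/-- The mirror-invariant lattices of index `k`. -/
noncomputable def mirrorLatticeEquiv {k : ℕ} (hk : k ≠ 0) :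
    (Σ p : k.divisorsAntidiagonal, Σ L : PlaneLattice p.1.2, TwoTorsion L.1) ≃
      {Λ : AddSubgroup (ℤ × (ℤ × ℤ)) // IsMirrorInvariant Λ ∧ Λ.index = k} :=
  Equiv.trans
    (β := {d : Σ p : k.divisorsAntidiagonal, Σ L : PlaneLattice p.1.2, (ℤ × ℤ) ⧸ L.1 //
      2 • d.2.2 = 0})
    { toFun := fun d => ⟨⟨d.1, d.2.1, d.2.2.1⟩, d.2.2.2⟩
      invFun := fun d => ⟨d.1.1, d.1.2.1, ⟨d.1.2.2, d.2⟩⟩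
      left_inv := fun _ => rfl
      right_inv := fun _ => rfl } <|
  Equiv.trans
    (β := {Λ : {Λ : AddSubgroup (ℤ × (ℤ × ℤ)) // Λ.index = k} // IsMirrorInvariant Λ.1})
    ((slopeEquiv (ℤ × ℤ) hk).subtypeEquiv fun d => by
      have h := (Nat.mem_divisorsAntidiagonal.1 d.1.2).1
      have hpos : 0 < d.1.1.1 := Nat.pos_of_ne_zero (by intro h0; rw [h0] at h; simp at h; omega)
      exact (isMirrorInvariant_slopeSubgroup_iff hpos).symm)
    { toFun := fun Λ => ⟨Λ.1.1, Λ.2, Λ.1.2⟩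
      invFun := fun Λ => ⟨⟨Λ.1, Λ.2.2⟩, Λ.2.1⟩
      left_inv := fun _ => rfl
      right_inv := fun _ => rfl }

theorem card_mirrorLattice {n : ℕ} (hn : n ≠ 0) :
    Nat.card {Λ : AddSubgroup (ℤ × (ℤ × ℤ)) // IsMirrorInvariant Λ ∧ 4 * Λ.index = n}
      = if 4 ∣ n then ∑ p ∈ (n / 4).divisorsAntidiagonal, torsionMarkedCount p.2 else 0 := by
  split_ifs with h
  · obtain ⟨k, rfl⟩ := h
    have hk : k ≠ 0 := by omega
    rw [Nat.mul_div_cancel_left k (by norm_num),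
      Nat.card_congr (Equiv.subtypeEquivRight (q := fun Λ => IsMirrorInvariant Λ ∧ Λ.index = k)
        fun Λ => and_congr Iff.rfl (by omega)),
      ← Nat.card_congr (mirrorLatticeEquiv hk)]
    have hfin : ∀ p : k.divisorsAntidiagonal, Finite (Σ L : PlaneLattice p.1.2, TwoTorsion L.1) :=
      fun p => (finite_and_torsionMarkedCount_eq (by
        have h := (Nat.mem_divisorsAntidiagonal.1 p.2).1
        intro h0; rw [h0] at h; simp at h; omega)).1
    rw [Nat.card_sigma, ← Finset.sum_coe_sort _ fun p : ℕ × ℕ => torsionMarkedCount p.2]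
    rfl
  · have : IsEmpty {Λ : AddSubgroup (ℤ × (ℤ × ℤ)) // IsMirrorInvariant Λ ∧ 4 * Λ.index = n} :=
      ⟨fun Λ => h ⟨_, Λ.2.2.symm⟩⟩
    exact Nat.card_of_isEmpty

theorem two_mem_slopeSubgroup_one_iff {L : AddSubgroup (ℤ × ℤ)} {t : (ℤ × ℤ) ⧸ L} :
    ((2, 0) : ℤ × (ℤ × ℤ)) ∈ slopeSubgroup 1 L t ↔ 2 • t = 0 := by
  rw [mem_slopeSubgroup]
  constructor
  · rintro ⟨j, h1, h2⟩
    obtain rfl : j = 2 := by simpa using h1.symm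
    rw [two_nsmul, ← two_zsmul, ← h2]
    rfl
  · intro h
    refine ⟨2, by simp, ?_⟩
    rw [two_zsmul, ← two_nsmul, h]
    rfl

theorem two_mem_slopeSubgroup_two_iff {L : AddSubgroup (ℤ × ℤ)} {t : (ℤ × ℤ) ⧸ L} :
    ((2, 0) : ℤ × (ℤ × ℤ)) ∈ slopeSubgroup 2 L t ↔ t = 0 :=
  (mem_slopeSubgroup_self (e := 2) two_pos).trans eq_comm

/-- The lattices of index `k` containing `(2, 0)`. -/
noncomputable def latticeWithTwoEquiv {k : ℕ} (hk : k ≠ 0) :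
    ((Σ L : PlaneLattice k, TwoTorsion L.1) ⊕ {L : AddSubgroup (ℤ × ℤ) // 2 * L.index = k}) ≃
      {Λ : AddSubgroup (ℤ × (ℤ × ℤ)) // (2, 0) ∈ Λ ∧ Λ.index = k} :=
  Equiv.ofBijective
    (Sum.elim
      (fun d => ⟨slopeSubgroup 1 d.1.1 d.2.1, two_mem_slopeSubgroup_one_iff.2 d.2.2, by
        rw [index_slopeSubgroup one_pos, one_mul, d.1.2]⟩)
      (fun L => ⟨slopeSubgroup 2 L.1 0, two_mem_slopeSubgroup_two_iff.2 rfl, by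
        rw [index_slopeSubgroup two_pos, L.2]⟩)) <| by
    constructor
    · rintro (⟨⟨L, hL⟩, ⟨t, ht⟩⟩ | ⟨L, hL⟩) (⟨⟨L', hL'⟩, ⟨t', ht'⟩⟩ | ⟨L', hL'⟩) h
      · obtain ⟨-, rfl, h3⟩ := slopeSubgroup_injective one_pos one_pos (Subtype.ext_iff.1 h)
        obtain rfl := eq_of_heq h3
        rfl
      · exact absurd (slopeSubgroup_injective one_pos two_pos (Subtype.ext_iff.1 h)).1 (by norm_num)
      · exact absurd (slopeSubgroup_injective two_pos one_pos (Subtype.ext_iff.1 h)).1 (by norm_num)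
      · obtain ⟨-, rfl, -⟩ := slopeSubgroup_injective two_pos two_pos (Subtype.ext_iff.1 h)
        rfl
    · rintro ⟨Λ, h2, hΛ⟩
      obtain ⟨e, L, t, he, rfl⟩ : ∃ (e : ℕ) (L : AddSubgroup (ℤ × ℤ)) (t : (ℤ × ℤ) ⧸ L),
          0 < e ∧ Λ = slopeSubgroup e L t := exists_eq_slopeSubgroup Λ (by omega)
      have hdvd : e ∣ 2 := by
        obtain ⟨j, hj, -⟩ := h2
        exact Int.natCast_dvd_natCast.1 ⟨j, hj⟩
      have hi : e * L.index = k := (index_slopeSubgroup he).symm.trans hΛ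
      rcases (Nat.dvd_prime Nat.prime_two).1 hdvd with rfl | rfl
      · exact ⟨Sum.inl ⟨⟨L, by omega⟩, ⟨t, two_mem_slopeSubgroup_one_iff.1 h2⟩⟩, rfl⟩
      · obtain rfl := two_mem_slopeSubgroup_two_iff.1 h2
        exact ⟨Sum.inr ⟨L, hi⟩, rfl⟩

/-- The torsion-marked lattices of index `k` containing `(2, 0)`. -/
noncomputable def markedLatticeWithTwoEquiv {k : ℕ} (hk : k ≠ 0) :
    ((Σ L : PlaneLattice k, TwoTorsion L.1 × TwoTorsion L.1) ⊕
      ((Σ L : {L : AddSubgroup (ℤ × ℤ) // 2 * L.index = k}, TwoTorsion L.1) ⊕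
        (Σ L : {L : AddSubgroup (ℤ × ℤ) // 2 * L.index = k}, TwoTorsion L.1))) ≃
      Σ Λ : {Λ : AddSubgroup (ℤ × (ℤ × ℤ)) // (2, 0) ∈ Λ ∧ Λ.index = k}, TwoTorsion Λ.1 := by
  refine Equiv.trans ?_ (Equiv.sigmaCongrLeft
    (β := fun Λ : {Λ : AddSubgroup (ℤ × (ℤ × ℤ)) // (2, 0) ∈ Λ ∧ Λ.index = k} => TwoTorsion Λ.1)
    (latticeWithTwoEquiv hk))
  refine Equiv.trans ?_ (Equiv.sumSigmaDistrib _).symm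
  refine Equiv.sumCongr ?_ ?_
  · refine Equiv.trans ?_ (Equiv.sigmaAssoc fun (L : PlaneLattice k) (t : TwoTorsion L.1) =>
      TwoTorsion (slopeSubgroup 1 L.1 t.1)).symm
    refine Equiv.sigmaCongrRight fun L => (Equiv.sigmaEquivProd _ _).symm.trans
      (Equiv.sigmaCongrRight fun t => ?_)
    have : IsEmpty {s : (ℤ × ℤ) ⧸ L.1 // Even 1 ∧ 2 • s = t.1} :=
      ⟨fun s => absurd s.2.1 (by decide)⟩
    exact (Equiv.sumEmpty _ {s : (ℤ × ℤ) ⧸ L.1 // Even 1 ∧ 2 • s = t.1}).symm.trans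
      (twoTorsionSlopeEquiv one_pos L.1 t.1)
  · refine (Equiv.sigmaSumDistrib _ _).symm.trans (Equiv.sigmaCongrRight fun L => ?_)
    exact (Equiv.sumCongr (Equiv.refl _)
      (Equiv.subtypeEquivRight fun s => ⟨fun h => ⟨even_two, h⟩, fun h => h.2⟩)).trans
      (twoTorsionSlopeEquiv two_pos L.1 0)

theorem finite_and_card_marked_double {k : ℕ} (hk : k ≠ 0) :
    Finite (Σ L : {L : AddSubgroup (ℤ × ℤ) // 2 * L.index = k}, TwoTorsion L.1) ∧
    Nat.card (Σ L : {L : AddSubgroup (ℤ × ℤ) // 2 * L.index = k}, TwoTorsion L.1)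
      = if 2 ∣ k then torsionMarkedCount (k / 2) else 0 := by
  split_ifs with h
  · obtain ⟨m, rfl⟩ := h
    have hm : m ≠ 0 := by omega
    have E : (Σ L : PlaneLattice m, TwoTorsion L.1) ≃
        Σ L : {L : AddSubgroup (ℤ × ℤ) // 2 * L.index = 2 * m}, TwoTorsion L.1 :=
      Equiv.sigmaCongrLeft
        (β := fun L : {L : AddSubgroup (ℤ × ℤ) // 2 * L.index = 2 * m} => TwoTorsion L.1)
        (Equiv.subtypeEquivRight fun L => by omega)
    have := (finite_and_torsionMarkedCount_eq hm).1
    rw [Nat.mul_div_cancel_left m two_pos]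
    exact ⟨Finite.of_equiv _ E, (Nat.card_congr E).symm⟩
  · have : IsEmpty {L : AddSubgroup (ℤ × ℤ) // 2 * L.index = k} := ⟨fun L => h ⟨_, L.2.symm⟩⟩
    exact ⟨inferInstance, Nat.card_of_isEmpty⟩

theorem card_marked_latticeWithTwo {n : ℕ} (hn : n ≠ 0) :
    Nat.card (Σ Λ : {Λ : AddSubgroup (ℤ × (ℤ × ℤ)) // (2, 0) ∈ Λ ∧ 2 * Λ.index = n}, TwoTorsion Λ.1)
      = (if 2 ∣ n then torsionBimarkedCount (n / 2) else 0)
        + 2 * (if 4 ∣ n then torsionMarkedCount (n / 4) else 0) := by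
  by_cases h : 2 ∣ n
  · obtain ⟨k, rfl⟩ := h
    have hk : k ≠ 0 := by omega
    have E : (Σ Λ : {Λ : AddSubgroup (ℤ × (ℤ × ℤ)) // (2, 0) ∈ Λ ∧ Λ.index = k}, TwoTorsion Λ.1) ≃
        Σ Λ : {Λ : AddSubgroup (ℤ × (ℤ × ℤ)) // (2, 0) ∈ Λ ∧ 2 * Λ.index = 2 * k}, TwoTorsion Λ.1 :=
      Equiv.sigmaCongrLeft (β := fun Λ : {Λ : AddSubgroup (ℤ × (ℤ × ℤ)) //
          (2, 0) ∈ Λ ∧ 2 * Λ.index = 2 * k} => TwoTorsion Λ.1)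
        (Equiv.subtypeEquivRight fun L => and_congr Iff.rfl (by omega))
    obtain ⟨h1, h2⟩ := finite_and_card_marked_double hk
    have h3 := (finite_and_torsionBimarkedCount_eq hk).1
    rw [← Nat.card_congr E, ← Nat.card_congr (markedLatticeWithTwoEquiv hk), Nat.card_sum,
      Nat.card_sum, h2, if_pos (dvd_mul_right 2 k), Nat.mul_div_cancel_left k two_pos, ← two_mul]
    have h4 : 4 ∣ 2 * k ↔ 2 ∣ k := by omega
    have h5 : 2 * k / 4 = k / 2 := by omega
    rw [if_congr h4 (by rw [h5]) rfl]
    rfl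
  · have h4 : ¬ 4 ∣ n := by omega
    have : IsEmpty {Λ : AddSubgroup (ℤ × (ℤ × ℤ)) // (2, 0) ∈ Λ ∧ 2 * Λ.index = n} :=
      ⟨fun L => h ⟨_, L.2.2.symm⟩⟩
    rw [if_neg h, if_neg h4, Nat.card_of_isEmpty]

section Rotations

variable {N : Subgroup P2mModel}

theorem trans_nsmul (n : ℕ) (w : ℤ × (ℤ × ℤ)) : trans (n • w) = trans w ^ n := by
  induction n with
  | zero => simp [trans_zero]
  | succ n ih => rw [succ_nsmul, trans_add, ih, pow_succ]

theorem exists_period (hN : N.Normal) (h0 : N.index ≠ 0) :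
    ∃ d : ℕ, d ≤ N.index ∧ ∀ y : ℤ, (y, 0) ∈ translationLattice N ↔ (d : ℤ) ∣ y := by
  obtain ⟨a, ha⟩ := Int.subgroup_cyclic
    ((translationLattice N).comap (AddMonoidHom.inl ℤ (ℤ × ℤ)))
  rw [← AddSubgroup.zmultiples_eq_closure] at ha
  have key : ∀ y : ℤ, (y, 0) ∈ translationLattice N ↔ (a.natAbs : ℤ) ∣ y := by
    intro y
    rw [Int.natAbs_dvd, ← Int.mem_zmultiples_iff, ← ha]
    rfl
  refine ⟨a.natAbs, Nat.le_of_dvd (Nat.pos_of_ne_zero h0) ?_, key⟩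
  rw [← Int.natCast_dvd_natCast, ← key, mem_translationLattice]
  have := N.pow_index_mem (trans (1, 0))
  rw [← trans_nsmul] at this
  simpa using this

theorem mem_iff_mem_of_trans_mem {g h : P2mModel} (hs : g.s = h.s) (hu : g.u = h.u)
    (hgh : trans (g.y - h.y, g.v - h.v) ∈ N) : g ∈ N ↔ h ∈ N := by
  rw [← mul_inv_eq_trans hs hu] at hgh
  refine ⟨fun hg => ?_, fun hh => ?_⟩
  · simpa using mul_mem (inv_mem hgh) hg
  · simpa using mul_mem hgh hh

/-- Representatives modulo the translations by `d * ℤ` and `2 * ℤ²` of the isometries whose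
first translation part is a multiple of `d / 2`. -/
def residue (d : ℕ) (c : Bool × Bool × Bool × ℤˣ × ℤˣ) : P2mModel :=
  ⟨if c.1 then (d / 2 : ℕ) else 0,
    (if c.2.1 then 1 else 0, if c.2.2.1 then 1 else 0), c.2.2.2.1, c.2.2.2.2⟩

theorem exists_two_mul_eq_sub_ite (a : ℤ) :
    ∃ b : ℤ, 2 * b = a - (if decide (Odd a) then 1 else 0) := by
  rcases Int.even_or_odd a with h | h
  · have h' : ¬ Odd a := Int.not_odd_iff_even.2 h
    obtain ⟨b, rfl⟩ := h
    exact ⟨b, by simp only [h', decide_false]; simp; ring⟩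
  · obtain ⟨b, hb⟩ := id h
    exact ⟨b, by simp only [h, decide_true]; simp; linarith⟩

theorem mem_iff_residue_mem (hN : N.Normal) {k : P2mModel} (hk : k ∈ N) (hku : k.u = -1) {d : ℕ}
    (hd : ∀ y : ℤ, (y, 0) ∈ translationLattice N ↔ (d : ℤ) ∣ y) (g : P2mModel) :
    g ∈ N ↔ (d : ℤ) ∣ 2 * g.y ∧
      residue d (decide (¬ (d : ℤ) ∣ g.y), decide (Odd g.v.1), decide (Odd g.v.2), g.s, g.u) ∈ N := by
  have key : (d : ℤ) ∣ 2 * g.y → (g ∈ N ↔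
      residue d (decide (¬ (d : ℤ) ∣ g.y), decide (Odd g.v.1), decide (Odd g.v.2), g.s, g.u) ∈ N) := by
    rintro ⟨j, hj⟩
    refine mem_iff_mem_of_trans_mem rfl rfl ?_
    obtain ⟨b, hb⟩ := exists_two_mul_eq_sub_ite g.v.1
    obtain ⟨c, hc⟩ := exists_two_mul_eq_sub_ite g.v.2
    have hy : (d : ℤ) ∣ g.y - if decide (¬ (d : ℤ) ∣ g.y) then ((d / 2 : ℕ) : ℤ) else 0 := by
      by_cases h : (d : ℤ) ∣ g.y
      · simp [h]
      · simp only [h, not_false_eq_true, decide_true, if_true]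
        rcases Int.even_or_odd' j with ⟨i, rfl | rfl⟩
        · exact absurd ⟨i, by linarith⟩ h
        · have hev : Even d := by
            have : Even ((d : ℤ) * (2 * i + 1)) := ⟨g.y, by linarith⟩
            rcases Int.even_mul.1 this with h' | h'
            · exact_mod_cast h'
            · exact absurd h' (Int.not_even_iff_odd.2 ⟨i, rfl⟩)
          obtain ⟨f, rfl⟩ := hev
          have hf : (f + f) / 2 = f := by omega
          rw [hf]
          push_cast at hj ⊢
          exact ⟨i, by linarith⟩
    have h1 := add_mem ((hd _).2 hy) (two_nsmul_mem_of_u_eq hN hk hku (b, c))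
    rw [mem_translationLattice] at h1
    convert h1 using 2
    ext
    · simp [residue]
    · simp [residue, hb]
    · simp [residue, hc]
  constructor
  · intro hg
    have h2 := (hd _).1 (two_mul_y_mem hN hg)
    exact ⟨h2, (key h2).1 hg⟩
  · rintro ⟨h1, h2⟩
    exact (key h1).2 h2

/-- The normal subgroups of index `n` that do not act trivially on the directions of the second
factor. -/
abbrev RotationSubgroup (n : ℕ) : Type :=
  {N : Subgroup P2mModel // (N.Normal ∧ N.index = n) ∧ ¬ ∀ g ∈ N, g.u = 1}

theorem exists_sum_card_rotationSubgroup_le :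
    ∃ C : ℕ, ∀ X : ℕ, 1 ≤ X → ∑ n ∈ Finset.Icc 1 X, Nat.card (RotationSubgroup n) ≤ C * X := by
  refine ⟨2 * Nat.card (Set (Bool × Bool × Bool × ℤˣ × ℤˣ)), fun X hX => ?_⟩
  have hper : ∀ q : Σ n : Finset.Icc 1 X, RotationSubgroup n.1, ∃ d : Fin (X + 1),
      ∀ y : ℤ, (y, 0) ∈ translationLattice q.2.1 ↔ (d.1 : ℤ) ∣ y := by
    rintro ⟨⟨n, hn⟩, ⟨N, ⟨hN, hi⟩, -⟩⟩
    rw [Finset.mem_Icc] at hn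
    simp only at hi
    obtain ⟨d, h1, h2⟩ := exists_period hN (by omega)
    exact ⟨⟨d, by omega⟩, h2⟩
  choose d hd using hper
  let F : (Σ n : Finset.Icc 1 X, RotationSubgroup n.1) →
      Fin (X + 1) × Set (Bool × Bool × Bool × ℤˣ × ℤˣ) :=
    fun q => (d q, {c | residue (d q) c ∈ q.2.1})
  have hF : Function.Injective F := by
    intro q q' h
    obtain ⟨h1, h2⟩ := Prod.mk.inj h
    have hdq := hd q
    have hdq' := hd q'
    rw [← h1] at h2 hdq'
    generalize d q = e at h2 hdq hdq'
    obtain ⟨⟨n, hn⟩, ⟨N, ⟨hN, hi⟩, hu⟩⟩ := q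
    obtain ⟨⟨n', hn'⟩, ⟨N', ⟨hN', hi'⟩, hu'⟩⟩ := q'
    simp only at hi hi' hdq hdq' h2
    push Not at hu hu'
    obtain ⟨k, hk, hku⟩ := hu
    obtain ⟨k', hk', hku'⟩ := hu'
    obtain rfl : N = N' := by
      ext g
      rw [mem_iff_residue_mem hN hk ((Int.units_eq_one_or _).resolve_left hku) hdq,
        mem_iff_residue_mem hN' hk' ((Int.units_eq_one_or _).resolve_left hku') hdq']
      exact and_congr Iff.rfl (Set.ext_iff.1 h2 _)
    subst hi
    subst hi'
    rfl
  have hfin : Finite (Σ n : Finset.Icc 1 X, RotationSubgroup n.1) := Finite.of_injective F hF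
  have hfin' : ∀ n : Finset.Icc 1 X, Finite (RotationSubgroup n.1) := fun n =>
    Finite.of_injective (fun N => (⟨n, N⟩ : Σ n : Finset.Icc 1 X, RotationSubgroup n.1))
      fun _ _ h => eq_of_heq (Sigma.mk.inj h).2
  have hcard := Nat.card_le_card_of_injective F hF
  rw [Nat.card_sigma, Finset.sum_coe_sort _ fun n => Nat.card (RotationSubgroup n), Nat.card_prod,
    Nat.card_fin] at hcard
  refine hcard.trans ?_
  rw [mul_right_comm]
  exact Nat.mul_le_mul_right _ (by omega)

end Rotations

theorem normalSubgroupCount_eq {n : ℕ} (hn : n ≠ 0)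
    (hfin : Finite {N : Subgroup P2mModel // N.Normal ∧ N.index = n}) :
    normalSubgroupCount P2mModel n
      = (if 4 ∣ n then ∑ p ∈ (n / 4).divisorsAntidiagonal, torsionMarkedCount p.2 else 0)
        + ((if 2 ∣ n then torsionBimarkedCount (n / 2) else 0)
          + 2 * (if 4 ∣ n then torsionMarkedCount (n / 4) else 0))
        + Nat.card (RotationSubgroup n) := by
  classical
  have hsub : ∀ P : Subgroup P2mModel → Prop,
      Finite {N : Subgroup P2mModel // (N.Normal ∧ N.index = n) ∧ P N} := fun P =>
    Finite.of_injective
      (fun N => (⟨N.1, N.2.1⟩ : {N : Subgroup P2mModel // N.Normal ∧ N.index = n}))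
      fun N N' h => Subtype.ext (Subtype.mk.inj h)
  have split : ∀ P R : Subgroup P2mModel → Prop, Finite {N // P N} →
      Nat.card {N // P N} = Nat.card {N // P N ∧ R N} + Nat.card {N // P N ∧ ¬ R N} := by
    intro P R hP
    have h1 : Finite {N // P N ∧ R N} := Finite.of_injective
      (fun N => (⟨N.1, N.2.1⟩ : {N // P N})) fun N N' h => Subtype.ext (Subtype.mk.inj h)
    have h2 : Finite {N // P N ∧ ¬ R N} := Finite.of_injective
      (fun N => (⟨N.1, N.2.1⟩ : {N // P N})) fun N N' h => Subtype.ext (Subtype.mk.inj h)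
    rw [← Nat.card_sum]
    exact Nat.card_congr ((Equiv.sumCompl fun N : {N // P N} => R N.1).symm.trans
      (Equiv.sumCongr (Equiv.subtypeSubtypeEquivSubtypeInter P R)
        (Equiv.subtypeSubtypeEquivSubtypeInter P fun N => ¬ R N)))
  unfold normalSubgroupCount
  rw [split _ (fun N => ∀ g ∈ N, g.u = 1) hfin,
    split _ (fun N => ∀ g ∈ N, g.s = 1) (hsub _)]
  congr 1
  congr 1
  · rw [← card_mirrorLattice hn, Nat.card_congr (translationSubgroupEquiv n)]
    exact Nat.card_congr (Equiv.subtypeEquivRight fun N => and_assoc)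
  · rw [← card_marked_latticeWithTwo hn, Nat.card_congr (reflectionSubgroupEquiv n)]
    exact Nat.card_congr (Equiv.subtypeEquivRight fun N => and_assoc)

end P2mModel

namespace P2m

/-- The images of the generators in the concrete model. -/
def modelGen : P2mGen → P2mModel
  | .x => ⟨0, (1, 0), 1, 1⟩
  | .y => ⟨1, 0, 1, 1⟩
  | .z => ⟨0, (0, 1), 1, 1⟩
  | .r => ⟨0, 0, 1, -1⟩
  | .m => ⟨0, 0, -1, 1⟩

theorem lift_modelGen_relators : ∀ w ∈ relators, FreeGroup.lift modelGen w = 1 := by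
  simp only [relators, Set.mem_insert_iff, Set.mem_singleton_iff, forall_eq_or_imp, forall_eq]
  refine ⟨?_, ?_, ?_, ?_, ?_, ?_, ?_, ?_, ?_, ?_, ?_, ?_⟩ <;>
    ext <;> simp [X, Y, Z, R, M, modelGen, pow_two]

/-- The homomorphism from the presented group to the concrete model. -/
def toModel : P2mGroup →* P2mModel := PresentedGroup.toGroup lift_modelGen_relators

/-- The class of a generator. -/
def gen (a : P2mGen) : P2mGroup := PresentedGroup.of a

theorem toModel_gen (a : P2mGen) : toModel (gen a) = modelGen a :=
  PresentedGroup.toGroup.of lift_modelGen_relators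

theorem mk_eq_one {w : FreeGroup P2mGen} (hw : w ∈ relators) :
    PresentedGroup.mk relators w = 1 := PresentedGroup.one_of_mem hw

theorem commute_of_relator {G : Type*} [Group G] {a b : G} (h : a⁻¹ * b⁻¹ * a * b = 1) :
    Commute a b := by
  have : a * b = b * a := by
    calc a * b = b * a * (a⁻¹ * b⁻¹ * a * b) := by group
      _ = b * a := by rw [h, mul_one]
  exact this

theorem commute_xy : Commute (gen .x) (gen .y) :=
  commute_of_relator (mk_eq_one (w := X⁻¹ * Y⁻¹ * X * Y) (by simp [relators]))

theorem commute_xz : Commute (gen .x) (gen .z) :=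
  commute_of_relator (mk_eq_one (w := X⁻¹ * Z⁻¹ * X * Z) (by simp [relators]))

theorem commute_yz : Commute (gen .y) (gen .z) :=
  commute_of_relator (mk_eq_one (w := Y⁻¹ * Z⁻¹ * Y * Z) (by simp [relators]))

theorem r_sq : gen .r * gen .r = 1 := by
  rw [← pow_two]
  exact mk_eq_one (w := R ^ 2) (by simp [relators])

theorem m_sq : gen .m * gen .m = 1 := by
  rw [← pow_two]
  exact mk_eq_one (w := M ^ 2) (by simp [relators])

theorem commute_of_conj {G : Type*} [Group G] {a b : G} (h : b⁻¹ * a * b * a⁻¹ = 1) :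
    Commute b a := by
  have : b * a = a * b := by
    calc b * a = b * (b⁻¹ * a * b * a⁻¹) * a := by rw [h, mul_one]
      _ = a * b := by group
  exact this

theorem mul_zpow_of_conj {G : Type*} [Group G] {a b : G} (h : b⁻¹ * a * b * (a⁻¹)⁻¹ = 1) (n : ℤ) :
    b * a ^ n = a ^ (-n) * b := by
  have h1 : SemiconjBy b a a⁻¹ := by
    have h2 : a⁻¹ = b⁻¹ * a * b := by rw [mul_eq_one_iff_eq_inv, inv_inv] at h; exact h.symm
    change b * a = a⁻¹ * b
    calc b * a = b * (a⁻¹)⁻¹ := by rw [inv_inv]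
      _ = b * (b⁻¹ * a * b)⁻¹ := by rw [h2]
      _ = a⁻¹ * b := by group
  have := h1.zpow_right n
  rw [zpow_neg, ← inv_zpow]
  exact this

theorem commute_mr : Commute (gen .m) (gen .r) := by
  have h : (gen .m * gen .r) ^ 2 = 1 := mk_eq_one (w := (M * R) ^ 2) (by simp [relators])
  rw [pow_two] at h
  have h1 := eq_inv_of_mul_eq_one_left h
  rw [mul_inv_rev, inv_eq_of_mul_eq_one_left r_sq, inv_eq_of_mul_eq_one_left m_sq] at h1
  exact h1

theorem commute_mx : Commute (gen .m) (gen .x) :=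
  commute_of_conj (mk_eq_one (w := (M⁻¹ * X * M) * X⁻¹) (by simp [relators]))

theorem commute_mz : Commute (gen .m) (gen .z) :=
  commute_of_conj (mk_eq_one (w := (M⁻¹ * Z * M) * Z⁻¹) (by simp [relators]))

theorem commute_ry : Commute (gen .r) (gen .y) :=
  commute_of_conj (mk_eq_one (w := (R⁻¹ * Y * R) * Y⁻¹) (by simp [relators]))

theorem m_mul_y (n : ℤ) : gen .m * gen .y ^ n = gen .y ^ (-n) * gen .m :=
  mul_zpow_of_conj (mk_eq_one (w := (M⁻¹ * Y * M) * (Y⁻¹)⁻¹) (by simp [relators])) n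

theorem r_mul_x (n : ℤ) : gen .r * gen .x ^ n = gen .x ^ (-n) * gen .r :=
  mul_zpow_of_conj (mk_eq_one (w := (R⁻¹ * X * R) * (X⁻¹)⁻¹) (by simp [relators])) n

theorem r_mul_z (n : ℤ) : gen .r * gen .z ^ n = gen .z ^ (-n) * gen .r :=
  mul_zpow_of_conj (mk_eq_one (w := (R⁻¹ * Z * R) * (Z⁻¹)⁻¹) (by simp [relators])) n

/-- The power of `g` indicated by a sign. -/
def signPow (g : P2mGroup) (s : ℤˣ) : P2mGroup := if s = 1 then 1 else g

/-- The normal form. -/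
def ofModel (k : P2mModel) : P2mGroup :=
  gen .x ^ k.v.1 * gen .y ^ k.y * gen .z ^ k.v.2 * signPow (gen .m) k.s * signPow (gen .r) k.u

theorem signPow_neg {g : P2mGroup} (hg : g * g = 1) (s : ℤˣ) : g * signPow g s = signPow g (-s) := by
  rcases Int.units_eq_one_or s with rfl | rfl <;> simp [signPow, hg]

theorem gen_mul_ofModel (a : P2mGen) (k : P2mModel) :
    gen a * ofModel k = ofModel (modelGen a * k) := by
  obtain ⟨y, ⟨v, w⟩, s, u⟩ := k
  cases a
  · simp only [ofModel, modelGen]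
    simp only [P2mModel.mul_y, P2mModel.mul_v, P2mModel.mul_s, P2mModel.mul_u, Units.val_one,
      one_mul, one_smul, zero_add, Prod.mk_add_mk, zpow_add, zpow_one, mul_assoc]
  · simp only [ofModel, modelGen]
    simp only [P2mModel.mul_y, P2mModel.mul_v, P2mModel.mul_s, P2mModel.mul_u, Units.val_one,
      one_mul, one_smul, zero_add, zpow_add, zpow_one, mul_assoc]
    rw [← mul_assoc, ← (commute_xy.zpow_left v).eq, mul_assoc]
  · simp only [ofModel, modelGen]
    simp only [P2mModel.mul_y, P2mModel.mul_v, P2mModel.mul_s, P2mModel.mul_u, Units.val_one,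
      one_mul, one_smul, zero_add, Prod.mk_add_mk, zpow_add, zpow_one, mul_assoc]
    rw [← mul_assoc, ← (commute_xz.zpow_left v).eq, mul_assoc, ← mul_assoc (gen .z),
      ← (commute_yz.zpow_left y).eq, mul_assoc]
  · simp only [ofModel, modelGen]
    simp only [P2mModel.mul_y, P2mModel.mul_v, P2mModel.mul_s, P2mModel.mul_u, Units.val_one,
      Units.val_neg, one_mul, neg_smul, one_smul, neg_mul, zero_add, Prod.neg_mk, ← mul_assoc]
    have hs : gen .r * signPow (gen .m) s = signPow (gen .m) s * gen .r := by
      unfold signPow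
      split_ifs
      · simp
      · exact commute_mr.eq.symm
    rw [r_mul_x, mul_assoc _ (gen .r), (commute_ry.zpow_right y).eq, ← mul_assoc,
      mul_assoc _ (gen .r), r_mul_z, ← mul_assoc, mul_assoc _ (gen .r), hs, ← mul_assoc,
      mul_assoc _ (gen .r), signPow_neg r_sq]
  · simp only [ofModel, modelGen]
    simp only [P2mModel.mul_y, P2mModel.mul_v, P2mModel.mul_s, P2mModel.mul_u, Units.val_one,
      Units.val_neg, one_mul, one_smul, neg_mul, zero_add, ← mul_assoc]
    rw [(commute_mx.zpow_right v).eq, mul_assoc _ (gen .m), m_mul_y, ← mul_assoc,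
      mul_assoc _ (gen .m), (commute_mz.zpow_right w).eq, ← mul_assoc, mul_assoc _ (gen .m),
      signPow_neg m_sq]

theorem ofModel_toModel (g : P2mGroup) : ofModel (toModel g) = g := by
  have key : ∀ g : P2mGroup, ∀ k, g * ofModel k = ofModel (toModel g * k) := by
    intro g
    have hg : g ∈ Subgroup.closure (Set.range (PresentedGroup.of (rels := relators))) := by
      rw [PresentedGroup.closure_range_of]; trivial
    induction hg using Subgroup.closure_induction with
    | mem g hg =>
      obtain ⟨a, rfl⟩ := hg
      intro k
      rw [show toModel (PresentedGroup.of a) = modelGen a from toModel_gen a]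
      exact gen_mul_ofModel a k
    | one => simp
    | mul g h _ _ hg hh =>
      intro k
      rw [mul_assoc, hh, hg, map_mul, mul_assoc]
    | inv g _ hg =>
      intro k
      rw [inv_mul_eq_iff_eq_mul, hg, map_inv, mul_inv_cancel_left]
  have h1 : ofModel 1 = 1 := by simp [ofModel, signPow]
  simpa [h1] using (key g 1).symm

theorem toModel_x_zpow (n : ℤ) : toModel (gen .x) ^ n = ⟨0, (n, 0), 1, 1⟩ := by
  rw [toModel_gen]
  induction n using Int.induction_on with
  | zero => rfl
  | succ n ih => rw [zpow_add_one, ih]; ext <;> simp [modelGen]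
  | pred n ih => rw [zpow_sub_one, ih]; ext <;> simp [modelGen, sub_eq_add_neg]

theorem toModel_y_zpow (n : ℤ) : toModel (gen .y) ^ n = ⟨n, 0, 1, 1⟩ := by
  rw [toModel_gen]
  induction n using Int.induction_on with
  | zero => rfl
  | succ n ih => rw [zpow_add_one, ih]; ext <;> simp [modelGen]
  | pred n ih => rw [zpow_sub_one, ih]; ext <;> simp [modelGen, sub_eq_add_neg]

theorem toModel_z_zpow (n : ℤ) : toModel (gen .z) ^ n = ⟨0, (0, n), 1, 1⟩ := by
  rw [toModel_gen]
  induction n using Int.induction_on with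
  | zero => rfl
  | succ n ih => rw [zpow_add_one, ih]; ext <;> simp [modelGen]
  | pred n ih => rw [zpow_sub_one, ih]; ext <;> simp [modelGen, sub_eq_add_neg]

theorem toModel_ofModel (k : P2mModel) : toModel (ofModel k) = k := by
  have hm : toModel (signPow (gen .m) k.s) = ⟨0, 0, k.s, 1⟩ := by
    rcases Int.units_eq_one_or k.s with h | h
    · rw [h]; exact map_one toModel
    · rw [h]; exact toModel_gen .m
  have hr : toModel (signPow (gen .r) k.u) = ⟨0, 0, 1, k.u⟩ := by
    rcases Int.units_eq_one_or k.u with h | h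
    · rw [h]; exact map_one toModel
    · rw [h]; exact toModel_gen .r
  rw [ofModel, map_mul, map_mul, map_mul, map_mul, map_zpow, map_zpow, map_zpow, toModel_x_zpow,
    toModel_y_zpow, toModel_z_zpow, hm, hr]
  ext <;> simp

/-- The presented group `P2/m` is the concrete model. -/
def modelEquiv : P2mGroup ≃* P2mModel where
  toFun := toModel
  invFun := ofModel
  left_inv := ofModel_toModel
  right_inv := toModel_ofModel
  map_mul' := map_mul toModel

end P2m

/-- Isomorphic groups have corresponding normal subgroups of each index. -/
def MulEquiv.normalSubgroupsOfIndex {G H : Type*} [Group G] [Group H] (e : G ≃* H) (n : ℕ) :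
    {N : Subgroup G // N.Normal ∧ N.index = n} ≃ {N : Subgroup H // N.Normal ∧ N.index = n} :=
  e.mapSubgroup.toEquiv.subtypeEquiv fun N => by
    change _ ↔ (N.map e.toMonoidHom).Normal ∧ (N.map e.toMonoidHom).index = n
    refine and_congr ⟨fun h => h.map _ e.surjective, fun h => ?_⟩ ?_
    · rw [← Subgroup.comap_map_eq_self_of_injective (f := e.toMonoidHom) e.injective N]
      exact h.comap _
    · rw [show (N.map e.toMonoidHom).index = N.index from Subgroup.index_map_equiv N e]

theorem sum_divisorsAntidiagonal_dvd_fst {M : Type*} [AddCommMonoid M] {j : ℕ} (hj : 0 < j) (k : ℕ)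
    (g : ℕ → M) :
    ∑ p ∈ k.divisorsAntidiagonal, (if j ∣ p.1 then g p.2 else 0)
      = if j ∣ k then ∑ p ∈ (k / j).divisorsAntidiagonal, g p.2 else 0 := by
  rw [← Finset.sum_filter]
  split_ifs with h
  · obtain ⟨k, rfl⟩ := h
    rw [Nat.mul_div_cancel_left k hj]
    symm
    refine Finset.sum_nbij' (fun p => (j * p.1, p.2)) (fun p => (p.1 / j, p.2)) ?_ ?_ ?_ ?_ ?_
    · rintro ⟨a, c⟩ hp
      simp only [Nat.mem_divisorsAntidiagonal, Finset.mem_filter] at hp ⊢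
      obtain ⟨rfl, h0⟩ := hp
      exact ⟨⟨mul_assoc _ _ _, mul_ne_zero hj.ne' h0⟩, dvd_mul_right _ _⟩
    · rintro ⟨a, c⟩ hp
      simp only [Nat.mem_divisorsAntidiagonal, Finset.mem_filter] at hp ⊢
      obtain ⟨⟨h1, h0⟩, a, rfl⟩ := hp
      rw [mul_assoc] at h1
      rw [Nat.mul_div_cancel_left a hj]
      exact ⟨Nat.eq_of_mul_eq_mul_left hj h1, (mul_ne_zero_iff.1 h0).2⟩
    · rintro ⟨a, c⟩ _
      simp [Nat.mul_div_cancel_left a hj]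
    · rintro ⟨a, c⟩ hp
      simp [Nat.mul_div_cancel' (Finset.mem_filter.1 hp).2]
    · rintro ⟨a, c⟩ _
      rfl
  · refine Finset.sum_eq_zero fun p hp => ?_
    rw [Finset.mem_filter, Nat.mem_divisorsAntidiagonal] at hp
    exact absurd (hp.1.1 ▸ hp.2.mul_right p.2) h

theorem sum_divisorsAntidiagonal_dvd_snd {M : Type*} [AddCommMonoid M] {j : ℕ} (hj : 0 < j) (k : ℕ)
    (g : ℕ → M) :
    ∑ p ∈ k.divisorsAntidiagonal, (if j ∣ p.2 then g p.2 else 0)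
      = if j ∣ k then ∑ p ∈ (k / j).divisorsAntidiagonal, g (j * p.2) else 0 := by
  rw [← Finset.sum_filter]
  split_ifs with h
  · obtain ⟨k, rfl⟩ := h
    rw [Nat.mul_div_cancel_left k hj]
    symm
    refine Finset.sum_nbij' (fun p => (p.1, j * p.2)) (fun p => (p.1, p.2 / j)) ?_ ?_ ?_ ?_ ?_
    · rintro ⟨a, c⟩ hp
      simp only [Nat.mem_divisorsAntidiagonal, Finset.mem_filter] at hp ⊢
      obtain ⟨rfl, h0⟩ := hp
      exact ⟨⟨mul_left_comm _ _ _, mul_ne_zero hj.ne' h0⟩, dvd_mul_right _ _⟩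
    · rintro ⟨a, c⟩ hp
      simp only [Nat.mem_divisorsAntidiagonal, Finset.mem_filter] at hp ⊢
      obtain ⟨⟨h1, h0⟩, c, rfl⟩ := hp
      rw [mul_left_comm] at h1
      rw [Nat.mul_div_cancel_left c hj]
      exact ⟨Nat.eq_of_mul_eq_mul_left hj h1, (mul_ne_zero_iff.1 h0).2⟩
    · rintro ⟨a, c⟩ _
      simp [Nat.mul_div_cancel_left c hj]
    · rintro ⟨a, c⟩ hp
      simp [Nat.mul_div_cancel' (Finset.mem_filter.1 hp).2]
    · rintro ⟨a, c⟩ _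
      rfl
  · refine Finset.sum_eq_zero fun p hp => ?_
    rw [Finset.mem_filter, Nat.mem_divisorsAntidiagonal] at hp
    exact absurd (hp.1.1 ▸ hp.2.mul_left p.1) h

/-- The sum of the divisors, as a real number. -/
noncomputable def divisorTotal : ℕ → ℝ := divisorSum fun n => (n : ℝ)

theorem evenInd_eq_ite (n : ℕ) : ((evenInd n : ℕ) : ℝ) = if 2 ∣ n then 1 else 0 := by
  unfold evenInd
  simp only [even_iff_two_dvd, Nat.cast_ite, Nat.cast_one, Nat.cast_zero]

theorem sum_mul_evenInd_fst (k : ℕ) :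
    ∑ p ∈ k.divisorsAntidiagonal, (p.2 : ℝ) * evenInd p.1 = dilate 2 divisorTotal k := by
  simp only [evenInd_eq_ite, mul_ite, mul_one, mul_zero]
  rw [sum_divisorsAntidiagonal_dvd_fst two_pos k fun c => (c : ℝ)]
  rfl

theorem sum_mul_evenInd_snd (k : ℕ) :
    ∑ p ∈ k.divisorsAntidiagonal, (p.2 : ℝ) * evenInd p.2 = 2 * dilate 2 divisorTotal k := by
  simp only [evenInd_eq_ite, mul_ite, mul_one, mul_zero]
  rw [sum_divisorsAntidiagonal_dvd_snd two_pos k fun c => (c : ℝ)]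
  simp only [dilate, divisorTotal, divisorSum, mul_ite, mul_zero, Finset.mul_sum, Nat.cast_mul,
    Nat.cast_ofNat]

theorem sum_mul_evenInd_fst_mul_evenInd_snd (k : ℕ) :
    ∑ p ∈ k.divisorsAntidiagonal, (p.2 : ℝ) * (evenInd p.1 * evenInd p.2)
      = 2 * dilate 2 (dilate 2 divisorTotal) k := by
  have h1 : ∀ p : ℕ × ℕ, (p.2 : ℝ) * (evenInd p.1 * evenInd p.2)
      = if 2 ∣ p.1 then (p.2 : ℝ) * evenInd p.2 else 0 := by
    intro p
    rw [evenInd_eq_ite p.1]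
    split_ifs <;> simp
  simp only [h1]
  rw [sum_divisorsAntidiagonal_dvd_fst two_pos k fun c => (c : ℝ) * evenInd c]
  simp only [sum_mul_evenInd_snd, dilate, mul_ite, mul_zero]

theorem torsionMarkedCount_eq {k : ℕ} (hk : 1 ≤ k) :
    (torsionMarkedCount k : ℝ) = divisorTotal k + 3 * dilate 2 divisorTotal k := by
  rw [(finite_and_torsionMarkedCount_eq (by omega)).2]
  push_cast
  simp only [mul_add, mul_one, Finset.sum_add_distrib, sum_mul_evenInd_fst, sum_mul_evenInd_snd]
  rw [divisorTotal, divisorSum]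
  ring

theorem torsionBimarkedCount_eq {k : ℕ} (hk : 1 ≤ k) :
    (torsionBimarkedCount k : ℝ) = divisorTotal k + 9 * dilate 2 divisorTotal k
      + 6 * dilate 2 (dilate 2 divisorTotal) k := by
  rw [(finite_and_torsionBimarkedCount_eq (by omega)).2]
  push_cast
  simp only [mul_add, mul_one, Finset.sum_add_distrib, mul_left_comm _ (3 : ℝ), ← Finset.mul_sum,
    sum_mul_evenInd_fst, sum_mul_evenInd_snd, sum_mul_evenInd_fst_mul_evenInd_snd]
  rw [divisorTotal, divisorSum]
  ring

theorem quadraticMean_divisorTotal : QuadraticMean divisorTotal (Real.pi ^ 2 / 12) 1 := by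
  have := QuadraticMean.cast_id.divisorSum
  rwa [show (1 / 2 : ℝ) * (Real.pi ^ 2 / 6) = Real.pi ^ 2 / 12 by ring] at this

theorem quadraticMean_torsionMarkedCount :
    QuadraticMean (fun k => (torsionMarkedCount k : ℝ)) (7 * Real.pi ^ 2 / 48) 1 := by
  have h := quadraticMean_divisorTotal
  have h2 := (h.add ((h.dilate two_pos).const_mul 3)).congr fun k hk => torsionMarkedCount_eq hk
  convert h2 using 1
  push_cast
  ring

theorem quadraticMean_torsionBimarkedCount :
    QuadraticMean (fun k => (torsionBimarkedCount k : ℝ)) (29 * Real.pi ^ 2 / 96) 1 := by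
  have h := quadraticMean_divisorTotal
  have h2 := ((h.add ((h.dilate two_pos).const_mul 9)).add
    (((h.dilate two_pos).dilate two_pos).const_mul 6)).congr fun k hk => torsionBimarkedCount_eq hk
  convert h2 using 1
  push_cast
  ring

theorem normalSubgroupCount_P2mGroup_eq {n : ℕ} (hn : 1 ≤ n) :
    (normalSubgroupCount P2mGroup n : ℝ)
      = dilate 4 (divisorSum fun k => (torsionMarkedCount k : ℝ)) n
        + (dilate 2 (fun k => (torsionBimarkedCount k : ℝ)) n
          + 2 * dilate 4 (fun k => (torsionMarkedCount k : ℝ)) n)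
        + (Nat.card (P2mModel.RotationSubgroup n) : ℝ) := by
  have hn0 : n ≠ 0 := by omega
  have hfin := finite_normalSubgroups_P2m n hn0
  have E := P2m.modelEquiv.normalSubgroupsOfIndex n
  have h : normalSubgroupCount P2mGroup n = normalSubgroupCount P2mModel n := Nat.card_congr E
  rw [h, P2mModel.normalSubgroupCount_eq hn0 (Finite.of_equiv _ E)]
  unfold dilate divisorSum
  push_cast
  rfl

theorem quadraticMean_normalSubgroupCount :
    QuadraticMean (fun n => (normalSubgroupCount P2mGroup n : ℝ))
      ((3 / 32 + 7 * Real.pi ^ 2 / 4608) * Real.pi ^ 2) 2 := by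
  obtain ⟨C, hC⟩ := P2mModel.exists_sum_card_rotationSubgroup_le
  have hrot : QuadraticMean (fun n => (Nat.card (P2mModel.RotationSubgroup n) : ℝ)) 0 2 :=
    QuadraticMean.of_sum_le (D := C) (Nat.cast_nonneg C) (fun n => Nat.cast_nonneg _)
      fun N hN => by exact_mod_cast hC N hN
  have h1 := quadraticMean_torsionMarkedCount
  have h2 := quadraticMean_torsionBimarkedCount.mono one_le_two
  have h3 := h1.divisorSum
  have h4 := h1.mono one_le_two
  have h5 := (((h3.dilate four_pos).add ((h2.dilate two_pos).add
    ((h4.dilate four_pos).const_mul 2))).add hrot).congr fun n hn => normalSubgroupCount_P2mGroup_eq hn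
  convert h5 using 1
  push_cast
  ring

theorem theorem5p2 :
    (fun x : ℝ =>
      (∑ n ∈ Finset.Icc 1 ⌊x⌋₊, (normalSubgroupCount P2mGroup n : ℝ))
        - (3 / 32 + 7 * Real.pi ^ 2 / 4608) * x ^ 2 * Real.pi ^ 2)
      =O[atTop] (fun x : ℝ => x * Real.log x ^ 2) := by
  refine quadraticMean_normalSubgroupCount.isBigO.congr_left fun x => ?_
  ring
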